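/- For $n\in\mathbb N$ consider the following game on the edge set of the complete graph $K_n$ with bias $(1:b)$. The game is played in rounds until every edge is claimed. In each round Maker first claims one unclaimed edge, and then Breaker claims $b$ unclaimed edges (all the remaining ones, if fewer than $b$ are left). Let $M$ be the graph on the vertex set of $K_n$ formed by Maker's edges at the end of the game, and let $P_{11}$ be the path on eleven vertices. Maker wins the game (the $P_{11}$-minor game) if $P_{11}$ is a minor of $M$, that is, if there are pairwise disjoint non-empty vertex sets $S_v$, $v\in V(P_{11})$, such that each $M[S_v]$ is connected and $M$ has an edge between $S_v$ and $S_w$ for every edge $vw$ of $P_{11}$; otherwise Breaker wins. RandomMaker always claims an edge chosen uniformly at random among all unclaimed edges, and CleverBreaker follows a deterministic strategy (which may depend on the whole course of the game so far) that maximizes his probability of winning against RandomMaker. **Theorem.** In the $P_{11}$-minor game with bias $b=0.99n$ (rounded to an integer up or down: $b=b(n)$ is any integer with $|b-0.99n|<1$), CleverBreaker wins with high probability against RandomMaker, that is, $$\lim_{n\to\infty}\Pr\bigl(\text{CleverBreaker wins against RandomMaker on } K_n \text{ with bias } (1:b(n))\bigr)=1 .$$ -/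

import Mathlib

open Filter Topology
open scoped ENNReal

/-- `H` is a minor of `G`: there are pairwise disjoint non-empty branch sets `S v`, each inducing a
connected subgraph of `G`, with an edge of `G` between `S v` and `S w` for every edge `vw` of `H`. -/
def IsGraphMinor {V W : Type*} (H : SimpleGraph W) (G : SimpleGraph V) : Prop :=
  ∃ S : W → Set V,
    (∀ v w, v ≠ w → Disjoint (S v) (S w)) ∧
    (∀ v, (S v).Nonempty ∧ (G.induce (S v)).Connected) ∧
    (∀ v w, H.Adj v w → ∃ x ∈ S v, ∃ y ∈ S w, G.Adj x y)

namespace MakerBreaker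

/-- The completed rounds of a game, latest round first. A round consists of the element claimed by
Maker followed by the set of elements claimed by Breaker. -/
abbrev History (α : Type*) := List (α × Finset α)

/-- The elements claimed by Maker. -/
def makerSet {α : Type*} [DecidableEq α] : History α → Finset α
  | [] => ∅
  | r :: h => insert r.1 (makerSet h)

/-- The elements claimed by Breaker. -/
def breakerSet {α : Type*} [DecidableEq α] : History α → Finset α
  | [] => ∅
  | r :: h => r.2 ∪ breakerSet h

/-- The elements of the board `X` that are still unclaimed. -/
def free {α : Type*} [DecidableEq α] (X : Finset α) (h : History α) : Finset α :=
  X \ (makerSet h ∪ breakerSet h)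

/-- A deterministic strategy for Breaker in the `(1 : b)` game on the board `X`. Knowing all the
completed rounds `h` and the element `e` that Maker has just claimed, Breaker answers with `b` of
the elements that are still unclaimed (with all of them, if there are fewer than `b`). -/
structure BreakerStrategy {α : Type*} [DecidableEq α] (X : Finset α) (b : ℕ) where
  /-- Breaker's answer. -/
  move : History α → α → Finset α
  /-- The answer consists of unclaimed elements. -/
  move_subset : ∀ h, ∀ e ∈ free X h, move h e ⊆ (free X h).erase e
  /-- The answer has the right size. -/
  card_move : ∀ h, ∀ e ∈ free X h, (move h e).card = min b ((free X h).erase e).card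

/-- One round between RandomMaker, who claims a uniformly random unclaimed element, and a Breaker
who answers according to `σ`. Nothing happens if the board is completely claimed. -/
noncomputable def randomMakerRound {α : Type*} [DecidableEq α] {X : Finset α} {b : ℕ}
    (σ : BreakerStrategy X b) (h : History α) : PMF (History α) :=
  open Classical in
  if hX : (free X h).Nonempty then
    (PMF.uniformOfFinset (free X h) hX).map (fun e => (e, σ.move h e) :: h)
  else PMF.pure h

/-- The law of the history after `t` rounds (of the whole game, if it has ended before). -/
noncomputable def randomMakerPlay {α : Type*} [DecidableEq α] {X : Finset α} {b : ℕ}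
    (σ : BreakerStrategy X b) : ℕ → PMF (History α)
  | 0 => PMF.pure []
  | t + 1 => (randomMakerPlay σ t).bind (randomMakerRound σ)

/-- The board of the games on graphs: the edges of the complete graph on `n` vertices. -/
def completeBoard (n : ℕ) : Finset (Sym2 (Fin n)) := (⊤ : SimpleGraph (Fin n)).edgeFinset

/-- The graph formed by Maker's edges. -/
def makerGraph {n : ℕ} (h : History (Sym2 (Fin n))) : SimpleGraph (Fin n) :=
  SimpleGraph.fromEdgeSet (makerSet h : Set (Sym2 (Fin n)))

/-- The probability that Breaker, using `σ`, wins against RandomMaker the game on `n` vertices in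
which Maker wants the graph of her edges to satisfy `P`. Every round claims at least one element, so
the board is completely claimed after as many rounds as it has elements, if not before. -/
noncomputable def breakerWinProb {n b : ℕ} (P : SimpleGraph (Fin n) → Prop)
    (σ : BreakerStrategy (completeBoard n) b) : ℝ≥0∞ :=
  (randomMakerPlay σ (completeBoard n).card).toOuterMeasure {h | ¬ P (makerGraph h)}

/-- The probability that CleverBreaker wins against RandomMaker: the greatest winning probability
of a deterministic strategy of Breaker. -/
noncomputable def cleverBreakerWinProb (n b : ℕ) (P : SimpleGraph (Fin n) → Prop) : ℝ≥0∞ :=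
  ⨆ σ : BreakerStrategy (completeBoard n) b, breakerWinProb P σ

end MakerBreaker

/-! Breaker closes vertices one at a time by claiming every unclaimed edge at them. An open vertex
is fresh (isolated), active (a centre of a double star) or queued. A Maker edge between two fresh
vertices creates a double star; one between a fresh and an active vertex adds a leaf, which is
queued; any other edge sends the at most four affected vertices to the queue. Breaker serves the
queue first, then active, then fresh vertices.

While the present queue has not been hit, paths that start at an open vertex have at most five
vertices, so a new edge creates paths with at most 5 + 5 = 10. After a hit, an edge that is not a
hit only joins vertices at which paths have at most three vertices. When the queue runs empty,
everything starts afresh. So Maker needs two hits on the same queue (`Sound.pathBound`,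
`Sound.after_maker`, `Sound.after_breaker`, `Playing.round`), since a path minor yields a path
(`not_isGraphMinor_pathGraph`).

Two hits are unlikely. The load, the number of unclaimed edges at the queue, falls by `b` per round
and rises by at most the number of new queue vertices times the number of open vertices. With `xn`
open and `gn` fresh vertices there are about `x²n²/2` unclaimed edges, and `g` is at least about
`x²`. If the load is small, the mean rise is about `2(2x-g)(x-g)n/x ≤ 0.88n < b`
(`Sound.sum_cost_le`, `drift_polynomial`, `unscaled_drift`). So the load is typically `O(n)`, a hit
has probability `O(1/n)` (`Sound.card_hit_le`), a double hit on a given queue `O(1/n²)`, and there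
are at most `n` rounds.

The function `potential` makes this precise. It is a supermartingale (`sum_potential_le`), equals 1
on unsafe histories and is `O(1/n)` initially (`potential_nil_le`). It charges order `1/n²` for each
future round, `weight²/n²` before the first hit on a queue and `weight/n` after it, the weight being
exponential in load over `n`. Near the end few edges are left and hits become likely, but by then so
few vertices are open that Breaker, once he has emptied the queue, empties it in every round
(`Calm`); a penalty in `excess` covers the event that the queue does not empty in time. -/

/-! ### Paths as duplicate-free chains -/

section Paths

variable {V : Type*}

/-- The list `l` enumerates the vertices of a path of `G`. -/
def IsPathList (G : SimpleGraph V) (l : List V) : Prop := l.IsChain G.Adj ∧ l.Nodup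

/-- Every path of `G` has at most `k` vertices. -/
def PathBound (G : SimpleGraph V) (k : ℕ) : Prop := ∀ l, IsPathList G l → l.length ≤ k

/-- Every path of `G` that starts at `v` has at most `k` vertices. -/
def StartBound (G : SimpleGraph V) (v : V) (k : ℕ) : Prop :=
  ∀ l, IsPathList G (v :: l) → l.length + 1 ≤ k

/-- `G'` arises from `G` by adding the edge `uv`. -/
def IsAddEdge (G G' : SimpleGraph V) (u v : V) : Prop :=
  u ≠ v ∧ ∀ x y, G'.Adj x y ↔ G.Adj x y ∨ (x = u ∧ y = v) ∨ (x = v ∧ y = u)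

variable {G G' : SimpleGraph V} {u v : V}

lemma IsAddEdge.symm (h : IsAddEdge G G' u v) : IsAddEdge G G' v u :=
  ⟨h.1.symm, fun x y => by rw [h.2 x y, or_comm (a := x = u ∧ y = v)]⟩

lemma IsPathList.reverse {l : List V} (h : IsPathList G l) : IsPathList G l.reverse := by
  refine ⟨?_, List.nodup_reverse.2 h.2⟩
  rw [List.isChain_reverse]
  exact h.1.imp fun a b hab => hab.symm

lemma isPathList_cons {a : V} {l : List V} :
    IsPathList G (a :: l) ↔ ((∀ y ∈ l.head?, G.Adj a y) ∧ a ∉ l) ∧ IsPathList G l := by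
  unfold IsPathList
  rw [List.isChain_cons, List.nodup_cons]
  tauto

/-- A path repeats no vertex, so it uses the new edge at most once; cutting there leaves two paths
of the old graph, one ending and one starting at an end of that edge. -/
lemma IsPathList.split_of_isAddEdge (h : IsAddEdge G G' u v) :
    ∀ l, IsPathList G' l → IsPathList G l ∨ ∃ l₁ x y l₂, l = l₁ ++ x :: y :: l₂ ∧
      IsPathList G (l₁ ++ [x]) ∧ IsPathList G (y :: l₂) ∧ ((x = u ∧ y = v) ∨ (x = v ∧ y = u))
  | [], _ => Or.inl ⟨List.isChain_nil, List.nodup_nil⟩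
  | [a], _ => Or.inl ⟨List.isChain_singleton a, List.nodup_singleton a⟩
  | a :: b :: t, hl => by
    obtain ⟨⟨hab, hat⟩, hbt⟩ := isPathList_cons.1 hl
    have ih := IsPathList.split_of_isAddEdge h (b :: t) hbt
    have hab' := hab b (by simp)
    rcases (h.2 a b).1 hab' with hG | hnew
    · rcases ih with ih | ⟨l₁, x, y, l₂, he, h1, h2, hxy⟩
      · left
        exact isPathList_cons.2 ⟨⟨by simpa using hG, hat⟩, ih⟩
      · right
        refine ⟨a :: l₁, x, y, l₂, by simp [he], ?_, h2, hxy⟩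
        rw [List.cons_append, isPathList_cons]
        refine ⟨⟨?_, ?_⟩, h1⟩
        · intro w hw
          cases l₁ with
          | nil =>
            simp at he hw
            rw [← hw, ← he.1]; exact hG
          | cons c l₁ =>
            simp at he hw
            rw [← hw, ← he.1]; exact hG
        · intro hmem
          apply hat
          rw [he]
          simp at hmem ⊢
          tauto
    · rcases ih with ih | ⟨l₁, x, y, l₂, he, h1, h2, hxy⟩
      · right
        exact ⟨[], a, b, t, rfl, ⟨List.isChain_singleton a, List.nodup_singleton a⟩, ih, hnew⟩
      · exfalso
        have hx : x ∈ b :: t := by rw [he]; simp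
        have hy : y ∈ b :: t := by rw [he]; simp
        have : a = x ∨ a = y := by
          rcases hnew with ⟨rfl, -⟩ | ⟨rfl, -⟩ <;> rcases hxy with ⟨h1, h2⟩ | ⟨h1, h2⟩ <;> tauto
        rcases this with rfl | rfl
        · exact hat hx
        · exact hat hy

lemma StartBound.of_prefix {l : List V} {x : V} {k : ℕ} (hx : StartBound G x k)
    (hl : IsPathList G (l ++ [x])) : l.length + 1 ≤ k := by
  have := hl.reverse
  rw [List.reverse_append] at this
  simpa using hx _ this

lemma PathBound.of_isAddEdge (h : IsAddEdge G G' u v) {i j k : ℕ} (hG : PathBound G k)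
    (hu : StartBound G u i) (hv : StartBound G v j) (hk : i + j ≤ k) : PathBound G' k := by
  intro l hl
  rcases IsPathList.split_of_isAddEdge h l hl with hl | ⟨l₁, x, y, l₂, rfl, h1, h2, hxy⟩
  · exact hG l hl
  · rw [List.length_append, List.length_cons, List.length_cons]
    rcases hxy with ⟨rfl, rfl⟩ | ⟨rfl, rfl⟩
    · have := hu.of_prefix h1
      have := hv _ h2
      omega
    · have := hv.of_prefix h1
      have := hu _ h2
      omega

lemma StartBound.mono {k m : ℕ} (h : StartBound G v k) (hkm : k ≤ m) : StartBound G v m :=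
  fun l hl => (h l hl).trans hkm

lemma StartBound.of_isAddEdge (h : IsAddEdge G G' u v) {z : V} {i j k : ℕ}
    (hz : StartBound G z k) (hu : StartBound G u i) (hv : StartBound G v j) (hk : i + j ≤ k) :
    StartBound G' z k := by
  intro l hl
  rcases IsPathList.split_of_isAddEdge h _ hl with hl | ⟨l₁, x, y, l₂, he, h1, h2, hxy⟩
  · exact hz l hl
  · have : l.length + 1 = (l₁ ++ x :: y :: l₂).length := by rw [← he]; simp
    rw [this, List.length_append, List.length_cons, List.length_cons]
    rcases hxy with ⟨rfl, rfl⟩ | ⟨rfl, rfl⟩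
    · have := hu.of_prefix h1
      have := hv _ h2
      omega
    · have := hv.of_prefix h1
      have := hu _ h2
      omega

/-- A refinement of `StartBound.of_isAddEdge` for a vertex that is not at the far end of a path
with three vertices starting at `u` or `v`. -/
lemma StartBound.of_isAddEdge_of_near (h : IsAddEdge G G' u v) {z : V}
    (hz : StartBound G z 5) (hu : StartBound G u 3) (hv : StartBound G v 3)
    (hzu : ∀ y, G.Adj u y → G.Adj y z → z = u) (hzv : ∀ y, G.Adj v y → G.Adj y z → z = v) :
    StartBound G' z 5 := by
  -- The part of the path up to the new edge has at most two vertices: with three, `z` would be at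
  -- distance two from `x`. Together with at most three beyond the edge this gives five.
  have key : ∀ (x : V) (l₁ l₂ : List V), StartBound G x 3 →
      (∀ y, G.Adj x y → G.Adj y z → z = x) → z :: l₂ = l₁ ++ [x] → IsPathList G (l₁ ++ [x]) →
      l₁.length ≤ 1 := by
    intro x l₁ l₂ hx hzx he h1
    have h3 := hx.of_prefix h1
    match l₁, he, h1, h3 with
    | [], _, _, _ => simp
    | [_], _, _, _ => simp
    | [a, b], he, h1, _ =>
      exfalso
      simp only [List.cons_append, List.nil_append, List.cons.injEq] at he
      obtain ⟨rfl, -⟩ := he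
      have hc := h1.1
      simp at hc
      have hn := h1.2
      simp at hn
      exact hn.1.2 (hzx b hc.2.symm hc.1.symm)
    | _ :: _ :: _ :: _, _, _, h3 => simp at h3; omega
  intro l hl
  rcases IsPathList.split_of_isAddEdge h _ hl with hl | ⟨l₁, x, y, l₂, he, h1, h2, hxy⟩
  · exact hz l hl
  · have hlen : l.length + 1 = (l₁ ++ x :: y :: l₂).length := by rw [← he]; simp
    have hpre : ∃ l', z :: l' = l₁ ++ [x] := by
      cases l₁ with
      | nil => simp at he; exact ⟨[], by simp [he.1]⟩
      | cons c l₁ => simp at he; exact ⟨l₁ ++ [x], by simp [he.1]⟩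
    obtain ⟨l', hl'⟩ := hpre
    rw [hlen, List.length_append, List.length_cons, List.length_cons]
    rcases hxy with ⟨rfl, rfl⟩ | ⟨rfl, rfl⟩
    · have := key _ _ _ hu hzu hl' h1
      have := hv _ h2
      omega
    · have := key _ _ _ hv hzv hl' h1
      have := hu _ h2
      omega

lemma startBound_one_of_isolated (h : ∀ y, ¬ G.Adj v y) : StartBound G v 1 := by
  intro l hl
  cases l with
  | nil => simp
  | cons a l => exact absurd ((isPathList_cons.1 hl).1.1 a (by simp)) (h a)

end Paths

/-! ### Minors and paths -/

/-- One step of threading a path through the branch sets of a path minor: cross `S` from `y` to `x`,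
then leave along `xz`. Disjointness from `S` keeps the result duplicate-free. -/
lemma exists_isPathList_append {V : Type*} {G : SimpleGraph V} {S : Set V}
    (hS : (G.induce S).Connected) {y x z : V} (hy : y ∈ S) (hx : x ∈ S) {l : List V}
    (hl : IsPathList G (z :: l)) (hxz : G.Adj x z) (hdis : ∀ w ∈ z :: l, w ∉ S) :
    ∃ l', IsPathList G (y :: l') ∧ l.length + 1 ≤ l'.length ∧
      ∀ w ∈ y :: l', w ∈ S ∨ w ∈ z :: l := by
  classical
  obtain ⟨p⟩ := hS.preconnected ⟨y, hy⟩ ⟨x, hx⟩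
  have key : ∀ (a c : S) (q : (G.induce S).Walk a c), q.IsPath → c.1 = x →
      ∃ l', IsPathList G (a.1 :: l') ∧ l.length + 1 ≤ l'.length ∧
        ∀ w ∈ a.1 :: l', (∃ s ∈ q.support, s.1 = w) ∨ w ∈ z :: l := by
    intro a c q
    induction q with
    | nil =>
      rename_i a
      intro _ hc
      refine ⟨z :: l, isPathList_cons.2 ⟨⟨?_, ?_⟩, hl⟩, by simp, ?_⟩
      · simpa [hc] using hxz
      · exact fun hm => hdis _ hm a.2
      · intro w hw
        rcases List.mem_cons.1 hw with rfl | hw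
        · left; exact ⟨a, by simp, rfl⟩
        · right; exact hw
    | cons hadj q ih =>
      rename_i a b c
      intro hq hc
      rw [SimpleGraph.Walk.cons_isPath_iff] at hq
      obtain ⟨l', h1, h2, h3⟩ := ih hq.1 hc
      refine ⟨b.1 :: l', isPathList_cons.2 ⟨⟨?_, ?_⟩, h1⟩, by simp; omega, ?_⟩
      · simpa using hadj
      · intro hm
        rcases h3 _ hm with ⟨s, hs, hsa⟩ | hm
        · exact hq.2 (Subtype.ext hsa ▸ hs)
        · exact hdis _ hm a.2
      · intro w hw
        rcases List.mem_cons.1 hw with rfl | hw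
        · left; exact ⟨a, by simp, rfl⟩
        · rcases h3 w hw with ⟨s, hs, hsw⟩ | hm
          · left; exact ⟨s, by simp [hs], hsw⟩
          · right; exact hm
  obtain ⟨l', h1, h2, h3⟩ := key _ _ p.toPath.1 p.toPath.2 rfl
  refine ⟨l', h1, h2, fun w hw => ?_⟩
  rcases h3 w hw with ⟨s, -, rfl⟩ | hm
  · left; exact s.2
  · right; exact hm

/-- A graph that has the path on `m` vertices as a minor contains a path with `m` vertices. -/
lemma not_isGraphMinor_pathGraph {V : Type*} {G : SimpleGraph V} {m : ℕ}
    (h : PathBound G m) : ¬ IsGraphMinor (SimpleGraph.pathGraph (m + 1)) G := by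
  rintro ⟨S, hdis, hS, hadj⟩
  -- The path is built backwards from the last branch set, so that its first vertex can be
  -- prescribed.
  have key : ∀ k, ∀ hk : k ≤ m, ∀ y ∈ S ⟨m - k, by omega⟩,
      ∃ l, IsPathList G (y :: l) ∧ k ≤ l.length ∧
        ∀ w ∈ y :: l, ∃ j : Fin (m + 1), m - k ≤ j.1 ∧ w ∈ S j := by
    intro k
    induction k with
    | zero =>
      intro hk y hy
      refine ⟨[], ⟨List.isChain_singleton _, List.nodup_singleton _⟩, by simp, ?_⟩
      intro w hw
      simp at hw
      exact ⟨⟨m - 0, by omega⟩, le_rfl, hw ▸ hy⟩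
    | succ k ih =>
      intro hk y hy
      obtain ⟨x, hx, z, hz, hxz⟩ := hadj ⟨m - (k + 1), by omega⟩ ⟨m - k, by omega⟩
        (SimpleGraph.pathGraph_adj.2 (Or.inl (by simp; omega)))
      obtain ⟨l, hl, hlen, hmem⟩ := ih (by omega) z hz
      have hd : ∀ w ∈ z :: l, w ∉ S ⟨m - (k + 1), by omega⟩ := by
        intro w hw hw'
        obtain ⟨j, hj, hwj⟩ := hmem w hw
        have hne : (⟨m - (k + 1), by omega⟩ : Fin (m + 1)) ≠ j := by
          intro he
          have := congrArg Fin.val he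
          simp at this
          omega
        exact Set.disjoint_left.1 (hdis _ _ hne) hw' hwj
      obtain ⟨l', h1, h2, h3⟩ := exists_isPathList_append (hS _).2 hy hx hl hxz hd
      refine ⟨l', h1, by omega, fun w hw => ?_⟩
      rcases h3 w hw with hw | hw
      · exact ⟨_, le_rfl, hw⟩
      · obtain ⟨j, hj, hwj⟩ := hmem w hw
        exact ⟨j, by omega, hwj⟩
  obtain ⟨y, hy⟩ := (hS ⟨m - m, by omega⟩).1
  obtain ⟨l, hl, hlen, -⟩ := key m le_rfl y hy
  have := h _ hl
  simp at this
  omega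

/-! ### Double stars -/

section DoubleStar

variable {V : Type*} {G G' : SimpleGraph V} {u v : V}

/-- The component of the edge `ab` is a double star: all other neighbours of `a` and `b` are
leaves. -/
def DoubleStar (G : SimpleGraph V) (a b : V) : Prop :=
  G.Adj a b ∧ (∀ x, G.Adj a x → x ≠ b → ∀ y, G.Adj x y → y = a) ∧
    ∀ x, G.Adj b x → x ≠ a → ∀ y, G.Adj x y → y = b

/-- `x` has distance at most two from `a`. -/
def Near (G : SimpleGraph V) (a x : V) : Prop :=
  x = a ∨ G.Adj a x ∨ ∃ y, G.Adj a y ∧ G.Adj y x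

lemma DoubleStar.symm {a b : V} (h : DoubleStar G a b) : DoubleStar G b a :=
  ⟨h.1.symm, h.2.2, h.2.1⟩

lemma DoubleStar.near_iff {a b x : V} (h : DoubleStar G a b) :
    Near G a x ↔ G.Adj a x ∨ G.Adj b x := by
  constructor
  · rintro (rfl | hx | ⟨y, hy, hyx⟩)
    · exact Or.inr h.1.symm
    · exact Or.inl hx
    · by_cases hyb : y = b
      · subst hyb; exact Or.inr hyx
      · obtain rfl := h.2.1 y hy hyb x hyx
        exact Or.inr h.1.symm
  · rintro (hx | hx)
    · exact Or.inr (Or.inl hx)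
    · exact Or.inr (Or.inr ⟨b, h.1, hx⟩)

/-- In a double star every vertex is within distance two of either centre, so `Near G a` describes
the whole component of `a`. -/
lemma DoubleStar.near_of_near {a b x y : V} (h : DoubleStar G a b) (hx : Near G a x)
    (hxy : G.Adj x y) : Near G a y := by
  by_cases hxa : x = a
  · subst hxa; exact Or.inr (Or.inl hxy)
  by_cases hxb : x = b
  · subst hxb; exact Or.inr (Or.inr ⟨x, h.1, hxy⟩)
  rcases h.near_iff.1 hx with hx | hx
  · exact Or.inl (h.2.1 x hx hxb y hxy)
  · rw [h.2.2 x hx hxa y hxy]; exact Or.inr (Or.inl h.1)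

lemma DoubleStar.startBound {a b : V} (h : DoubleStar G a b) : StartBound G a 3 := by
  intro l hl
  match l, hl with
  | [], _ => simp
  | [_], _ => simp
  | [_, _], _ => simp
  | x :: y :: z :: l, hl =>
    exfalso
    have hc := hl.1
    have hn := hl.2
    simp only [List.isChain_cons_cons] at hc
    simp at hn
    by_cases hxb : x = b
    · subst hxb
      exact hn.2.1.2.1 (h.2.2 y hc.2.1 (fun hya => hn.1.2.1 hya.symm) z hc.2.2.1).symm
    · exact hn.1.2.1 (h.2.1 x hc.1 hxb y hc.2.1).symm

lemma DoubleStar.of_isAddEdge_of_not_near {a b : V} (h : DoubleStar G a b)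
    (hadd : IsAddEdge G G' u v) (hu : ¬ Near G a u) (hv : ¬ Near G a v) :
    DoubleStar G' a b ∧ ∀ x, (G'.Adj a x ↔ G.Adj a x) ∧ (G'.Adj b x ↔ G.Adj b x) := by
  have key : ∀ x y, Near G a x → (G'.Adj x y ↔ G.Adj x y) := by
    intro x y hx
    rw [hadd.2 x y]
    constructor
    · rintro (h1 | ⟨rfl, -⟩ | ⟨rfl, -⟩)
      · exact h1
      · exact absurd hx hu
      · exact absurd hx hv
    · exact Or.inl
  have ha : Near G a a := Or.inl rfl
  have hb : Near G a b := Or.inr (Or.inl h.1)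
  refine ⟨⟨(key a b ha).2 h.1, ?_, ?_⟩, fun x => ⟨key a x ha, key b x hb⟩⟩
  · intro x hx hxb y hy
    have hx' := (key a x ha).1 hx
    exact h.2.1 x hx' hxb y ((key x y (Or.inr (Or.inl hx'))).1 hy)
  · intro x hx hxb y hy
    have hx' := (key b x hb).1 hx
    exact h.2.2 x hx' hxb y ((key x y (h.near_of_near hb hx')).1 hy)

/-- A double star stays a double star when a fresh vertex is attached to one of its centres. -/
lemma DoubleStar.of_isAddEdge_leaf {a b : V} (h : DoubleStar G a b)
    (hadd : IsAddEdge G G' u a) (hu : ∀ y, ¬ G.Adj u y) : DoubleStar G' a b := by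
  have hua : u ≠ a := hadd.1
  have hub : u ≠ b := fun hub => hu a (hub ▸ h.1.symm)
  refine ⟨(hadd.2 a b).2 (Or.inl h.1), ?_, ?_⟩
  · intro x hx hxb y hy
    rcases (hadd.2 a x).1 hx with h1 | ⟨h1, -⟩ | ⟨-, rfl⟩
    · rcases (hadd.2 x y).1 hy with h2 | ⟨rfl, -⟩ | ⟨rfl, -⟩
      · exact h.2.1 x h1 hxb y h2
      · exact absurd h1.symm (hu a)
      · exact absurd h1 (G.loopless.irrefl _)
    · exact absurd h1.symm hua
    · rcases (hadd.2 x y).1 hy with h2 | ⟨-, h2⟩ | ⟨h2, -⟩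
      · exact absurd h2 (hu y)
      · exact h2
      · exact absurd h2 hua
  · intro x hx hxa y hy
    rcases (hadd.2 b x).1 hx with h1 | ⟨h1, -⟩ | ⟨h1, -⟩
    · rcases (hadd.2 x y).1 hy with h2 | ⟨rfl, -⟩ | ⟨rfl, -⟩
      · exact h.2.2 x h1 hxa y h2
      · exact absurd h1.symm (hu b)
      · exact absurd rfl hxa
    · exact absurd h1.symm hub
    · exact absurd h1 h.1.symm.ne

lemma doubleStar_of_isolated (hadd : IsAddEdge G G' u v) (hu : ∀ y, ¬ G.Adj u y)
    (hv : ∀ y, ¬ G.Adj v y) : DoubleStar G' u v := by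
  refine ⟨(hadd.2 u v).2 (Or.inr (Or.inl ⟨rfl, rfl⟩)), ?_, ?_⟩
  · intro x hx hxv
    rcases (hadd.2 u x).1 hx with h1 | ⟨-, h1⟩ | ⟨h1, -⟩
    · exact absurd h1 (hu x)
    · exact absurd h1 hxv
    · exact absurd h1 hadd.1
  · intro x hx hxu
    rcases (hadd.2 v x).1 hx with h1 | ⟨h1, -⟩ | ⟨-, h1⟩
    · exact absurd h1 (hv x)
    · exact absurd h1.symm hadd.1
    · exact absurd h1 hxu

end DoubleStar

namespace MakerBreaker

/-! ### Breaker's bookkeeping -/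

/-- Breaker's bookkeeping. The vertices outside `queue ∪ active ∪ fresh` are closed: all edges at
them are claimed. Fresh vertices are isolated in Maker's graph, active vertices are centres of
double stars, and the vertices in the queue are being closed, at present the vertex `head`. The
proposition `hit` says that Maker has interfered with the present queue. -/
structure GameState (n : ℕ) where
  /-- The vertices waiting to be closed. -/
  queue : Finset (Fin n)
  /-- The open centres of double stars. -/
  active : Finset (Fin n)
  /-- The open isolated vertices. -/
  fresh : Finset (Fin n)
  /-- The vertex that is being closed. -/
  head : Fin n
  /-- Maker has interfered with the queue. -/
  hit : Prop

namespace GameState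

variable {n : ℕ}

/-- The vertices that are not closed. -/
def opened (s : GameState n) : Finset (Fin n) := s.queue ∪ s.active ∪ s.fresh

lemma mem_opened {s : GameState n} {x : Fin n} :
    x ∈ s.opened ↔ x ∈ s.queue ∨ x ∈ s.active ∨ x ∈ s.fresh := by
  simp [opened]

/-- The order in which Breaker closes the vertices. -/
def rank (s : GameState n) (x : Fin n) : ℕ :=
  if x = s.head then 0 else if x ∈ s.queue then 1 + x else if x ∈ s.active then 1 + n + x
  else if x ∈ s.fresh then 1 + 2 * n + x else 1 + 3 * n + x

/-- The blocks for head, queue, active, fresh and closed vertices do not overlap. Injectivity makes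
the head the only open vertex that can be partly closed. -/
lemma rank_injective (s : GameState n) : Function.Injective s.rank := by
  intro x y h
  have hx := x.2
  have hy := y.2
  unfold rank at h
  split_ifs at h <;> first | (subst_vars; rfl) | (apply Fin.ext; omega)

/-- The state after Breaker has closed all vertices that come before `v`, and claimed edges at `v`,
in the order given by `rank`. -/
def advance (s : GameState n) (v : Fin n) : GameState n where
  queue := insert v (s.queue.filter fun x => s.rank v < s.rank x)
  active := s.active.filter fun x => s.rank v < s.rank x
  fresh := s.fresh.filter fun x => s.rank v < s.rank x
  head := v
  hit := s.hit ∧ v ∈ s.queue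

/-- The active vertices in the components of the end vertices of `e`. -/
noncomputable def affected (G : SimpleGraph (Fin n)) (s : GameState n) (e : Sym2 (Fin n)) :
    Finset (Fin n) :=
  open Classical in s.active.filter fun a => ∃ x ∈ e, Near G a x

/-- Maker interferes with the queue by claiming `e`. -/
def IsHit (G : SimpleGraph (Fin n)) (s : GameState n) (e : Sym2 (Fin n)) : Prop :=
  (∃ x ∈ e, x ∈ s.queue) ∨
    ((∀ x ∈ e, x ∈ s.active) ∧ ∃ x ∈ e, ∃ z ∈ s.queue, z ≠ x ∧ ∃ y, G.Adj x y ∧ G.Adj y z)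

/-- The state after Maker has claimed `e`. -/
noncomputable def makerStep (G : SimpleGraph (Fin n)) (s : GameState n) (e : Sym2 (Fin n)) :
    GameState n :=
  open Classical in
  if ∀ x ∈ e, x ∈ s.fresh then
    { s with
      active := s.active ∪ s.fresh.filter (· ∈ e)
      fresh := s.fresh.filter (· ∉ e) }
  else if (∀ x ∈ e, x ∈ s.fresh ∨ x ∈ s.active) ∧ ∃ x ∈ e, x ∈ s.fresh then
    { s with
      queue := s.queue ∪ s.fresh.filter (· ∈ e)
      fresh := s.fresh.filter (· ∉ e) }
  else
    { s with
      queue := s.queue ∪ (affected G s e ∪ s.fresh.filter (· ∈ e))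
      active := s.active \ affected G s e
      fresh := s.fresh.filter (· ∉ e)
      hit := s.hit ∨ IsHit G s e }

/-- Take the least `k` such that more than `b` edges have an end of rank at most `k`: those with an
end of rank below `k` are all affordable, and the remaining moves are spent at rank `k`. -/
lemma exists_greedy (X : Finset (Sym2 (Fin n))) (r : Fin n → ℕ) {b : ℕ} (hb : b < X.card)
    (hX : ∀ e ∈ X, ∃ x, x ∈ e) :
    ∃ v, ∃ S ⊆ X, S.card = b ∧ (∀ e ∈ X, (∃ x ∈ e, r x < r v) → e ∈ S) ∧
      ∀ e ∈ S, ∃ x ∈ e, r x ≤ r v := by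
  classical
  have hex : ∃ k, b < (X.filter fun e => ∃ x ∈ e, r x ≤ k).card := by
    refine ⟨Finset.univ.sup r, ?_⟩
    rw [Finset.filter_true_of_mem]
    · exact hb
    · intro e he
      obtain ⟨x, hx⟩ := hX e he
      exact ⟨x, hx, Finset.le_sup (Finset.mem_univ x)⟩
  set k := Nat.find hex with hk
  have hk1 : b < (X.filter fun e => ∃ x ∈ e, r x ≤ k).card := Nat.find_spec hex
  have hk0 : (X.filter fun e => ∃ x ∈ e, r x < k).card ≤ b := by
    rcases Nat.eq_zero_or_pos k with h0 | h0
    · simp [h0]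
    · have := Nat.find_min hex (m := k - 1) (by omega)
      rw [not_lt] at this
      refine le_trans (Finset.card_le_card ?_) this
      apply Finset.monotone_filter_right
      rintro e - ⟨x, hx, h⟩
      exact ⟨x, hx, by omega⟩
  have hsub : (X.filter fun e => ∃ x ∈ e, r x < k) ⊆ X.filter fun e => ∃ x ∈ e, r x ≤ k := by
    apply Finset.monotone_filter_right
    rintro e - ⟨x, hx, h⟩
    exact ⟨x, hx, h.le⟩
  obtain ⟨v, hv⟩ : ∃ v, r v = k := by
    by_contra! hne
    have : (X.filter fun e => ∃ x ∈ e, r x ≤ k) = X.filter fun e => ∃ x ∈ e, r x < k := by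
      apply Finset.filter_congr
      intro e _
      refine exists_congr fun x => and_congr_right fun _ => ?_
      have := hne x
      omega
    rw [this] at hk1
    omega
  obtain ⟨S, h1, h2, h3⟩ := Finset.exists_subsuperset_card_eq hsub hk0 hk1.le
  refine ⟨v, S, h2.trans (Finset.filter_subset _ _), h3, ?_, ?_⟩
  · rintro e he hx
    exact h1 (Finset.mem_filter.2 ⟨he, hv ▸ hx⟩)
  · intro e he
    exact hv ▸ (Finset.mem_filter.1 (h2 he)).2

/-- Breaker's answer in the state `s` if `X` is the set of unclaimed edges, together with the
vertex that he has worked on last. -/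
def IsResponse (s : GameState n) (X : Finset (Sym2 (Fin n))) (b : ℕ)
    (q : Fin n × Finset (Sym2 (Fin n))) : Prop :=
  q.2 ⊆ X ∧ q.2.card = b ∧ (∀ e ∈ X, (∃ x ∈ e, s.rank x < s.rank q.1) → e ∈ q.2) ∧
      ∀ e ∈ q.2, ∃ x ∈ e, s.rank x ≤ s.rank q.1

lemma exists_isResponse (s : GameState n) (X : Finset (Sym2 (Fin n))) {b : ℕ} (hb : b < X.card) :
    ∃ q, IsResponse s X b q := by
  obtain ⟨v, S, h⟩ := exists_greedy X s.rank hb fun e _ => by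
    induction e with | _ x y => exact ⟨x, by simp⟩
  exact ⟨(v, S), h⟩

/-- Breaker's answer in the state `s` and the state that it leads to. -/
noncomputable def response (s : GameState n) (X : Finset (Sym2 (Fin n))) (b : ℕ) :
    Finset (Sym2 (Fin n)) × GameState n :=
  if hb : b < X.card then
    ((exists_isResponse s X hb).choose.2, s.advance (exists_isResponse s X hb).choose.1)
  else (X, s)

lemma response_subset (s : GameState n) (X : Finset (Sym2 (Fin n))) (b : ℕ) :
    (s.response X b).1 ⊆ X := by
  unfold response
  split_ifs with hb
  · exact (exists_isResponse s X hb).choose_spec.1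
  · exact Finset.Subset.refl _

lemma card_response (s : GameState n) (X : Finset (Sym2 (Fin n))) (b : ℕ) :
    (s.response X b).1.card = min b X.card := by
  unfold response
  split_ifs with hb
  · rw [(exists_isResponse s X hb).choose_spec.2.1, min_eq_left hb.le]
  · rw [min_eq_right (not_lt.1 hb)]

lemma exists_response_eq (s : GameState n) {X : Finset (Sym2 (Fin n))} {b : ℕ}
    (hb : b < X.card) : ∃ v, IsResponse s X b (v, (s.response X b).1) ∧
      (s.response X b).2 = s.advance v := by
  unfold response
  rw [dif_pos hb]
  exact ⟨_, (exists_isResponse s X hb).choose_spec, rfl⟩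

/-! ### The invariants -/

/-- The properties of the state that are preserved during the game. -/
structure Sound (G : SimpleGraph (Fin n)) (X : Finset (Sym2 (Fin n))) (s : GameState n) :
    Prop where
  head_mem : s.head ∈ s.queue
  disjoint_queue_active : Disjoint s.queue s.active
  disjoint_queue_fresh : Disjoint s.queue s.fresh
  disjoint_active_fresh : Disjoint s.active s.fresh
  isolated : ∀ x ∈ s.fresh, ∀ y, ¬ G.Adj x y
  star : ∀ a ∈ s.active, ∃ b, DoubleStar G a b ∧ ∀ c ∈ s.active, Near G a c → c = a ∨ c = b
  queue_bound : ¬ s.hit → ∀ z ∈ s.queue, StartBound G z 5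
  mem_opened : ∀ e ∈ X, ∀ x ∈ e, x ∈ s.opened
  not_adj : ∀ x y, s(x, y) ∈ X → x ≠ y ∧ ¬ G.Adj x y
  complete : ∀ x ∈ s.opened, ∀ y ∈ s.opened, x ≠ y → x ≠ s.head → y ≠ s.head →
    s(x, y) ∈ X ∨ G.Adj x y

variable {G G' : SimpleGraph (Fin n)} {X : Finset (Sym2 (Fin n))} {s s₁ : GameState n}
  {u v : Fin n}

lemma Sound.startBound_active (hs : Sound G X s) {a : Fin n} (ha : a ∈ s.active) :
    StartBound G a 3 := by
  obtain ⟨b, hb, -⟩ := hs.star a ha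
  exact hb.startBound

lemma Sound.startBound_fresh (hs : Sound G X s) {a : Fin n} (ha : a ∈ s.fresh) :
    StartBound G a 1 := startBound_one_of_isolated (hs.isolated a ha)

/-! ### Maker's half of a round -/

/-- The bookkeeping common to all types of Maker edges; what depends on the type is left in the
hypotheses, chiefly `hstar` and `hb`. -/
lemma Sound.of_maker (hs : Sound G X s) (hadd : IsAddEdge G G' u v) (hhead : s₁.head = s.head)
    (hq : s.queue ⊆ s₁.queue) (ho : s₁.opened = s.opened)
    (h1 : Disjoint s₁.queue s₁.active) (h2 : Disjoint s₁.queue s₁.fresh)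
    (h3 : Disjoint s₁.active s₁.fresh) (hf : ∀ x ∈ s₁.fresh, x ∈ s.fresh ∧ x ∉ s(u, v))
    (hstar : ∀ a ∈ s₁.active, ∃ b, DoubleStar G' a b ∧
      ∀ c ∈ s₁.active, Near G' a c → c = a ∨ c = b)
    (hb : ¬ s₁.hit → ∀ z ∈ s₁.queue, StartBound G' z 5) :
    Sound G' (X.erase s(u, v)) s₁ where
  head_mem := hhead ▸ hq hs.head_mem
  disjoint_queue_active := h1
  disjoint_queue_fresh := h2
  disjoint_active_fresh := h3
  isolated := by
    intro x hx y hxy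
    obtain ⟨h4, h5⟩ := hf x hx
    rw [Sym2.mem_iff, not_or] at h5
    rcases (hadd.2 x y).1 hxy with h | h | h
    · exact hs.isolated x h4 y h
    · exact h5.1 h.1
    · exact h5.2 h.1
  star := hstar
  queue_bound := hb
  mem_opened := fun e he => ho ▸ hs.mem_opened e (Finset.mem_of_mem_erase he)
  not_adj := by
    intro x y hxy
    rw [Finset.mem_erase] at hxy
    obtain ⟨h4, h5⟩ := hs.not_adj x y hxy.2
    refine ⟨h4, fun h => ?_⟩
    apply hxy.1
    rcases (hadd.2 x y).1 h with h | h | h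
    · exact absurd h h5
    · rw [h.1, h.2]
    · rw [h.1, h.2, Sym2.eq_swap]
  complete := by
    rw [ho, hhead]
    intro x hx y hy hxy hxh hyh
    rw [hadd.2 x y]
    by_cases he : s(x, y) = s(u, v)
    · right; right; simpa using he
    · rcases hs.complete x hx y hy hxy hxh hyh with h | h
      · left; exact Finset.mem_erase.2 ⟨he, h⟩
      · right; left; exact h

lemma Sound.near_iff_of_isolated (hs : Sound G X s) {a x : Fin n} (ha : a ∈ s.active)
    (hx : x ∈ s.fresh) : ¬ Near G a x := by
  rintro (rfl | h | ⟨y, -, h⟩)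
  · exact Finset.disjoint_left.1 hs.disjoint_active_fresh ha hx
  · exact hs.isolated x hx a h.symm
  · exact hs.isolated x hx y h.symm

lemma near_congr {a b x : Fin n} (h : DoubleStar G a b) (h' : DoubleStar G' a b)
    (hx : (G'.Adj a x ↔ G.Adj a x) ∧ (G'.Adj b x ↔ G.Adj b x)) : Near G' a x ↔ Near G a x := by
  rw [h.near_iff, h'.near_iff, hx.1, hx.2]

lemma Sound.fresh_fresh (hs : Sound G X s) (hadd : IsAddEdge G G' u v) (hu : u ∈ s.fresh)
    (hv : v ∈ s.fresh) : Sound G' (X.erase s(u, v)) (makerStep G s s(u, v)) := by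
  classical
  have hF : s.fresh.filter (· ∈ s(u, v)) = {u, v} := by
    ext x; simp
    rintro (rfl | rfl) <;> assumption
  have hstep : makerStep G s s(u, v) =
      { s with active := s.active ∪ {u, v}, fresh := s.fresh.filter (· ∉ s(u, v)) } := by
    unfold makerStep
    rw [if_pos (by simp [hu, hv])]
    simp only [← hF]
  rw [hstep]
  have hdu := Finset.disjoint_right.1 hs.disjoint_active_fresh hu
  have hdv := Finset.disjoint_right.1 hs.disjoint_active_fresh hv
  refine hs.of_maker hadd rfl (Finset.Subset.refl _) ?_ ?_ ?_ ?_ ?_ ?_ ?_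
  · ext x
    simp only [GameState.mem_opened, Finset.mem_union, Finset.mem_filter, Finset.mem_insert,
      Finset.mem_singleton, Sym2.mem_iff]
    by_cases h1 : x = u
    · subst h1; tauto
    · by_cases h2 : x = v
      · subst h2; tauto
      · tauto
  · rw [Finset.disjoint_union_right]
    refine ⟨hs.disjoint_queue_active, ?_⟩
    rw [Finset.disjoint_right]
    intro x hx
    rw [← hF] at hx
    exact Finset.disjoint_right.1 hs.disjoint_queue_fresh (Finset.mem_filter.1 hx).1
  · exact hs.disjoint_queue_fresh.mono_right (Finset.filter_subset _ _)
  · rw [Finset.disjoint_union_left]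
    refine ⟨hs.disjoint_active_fresh.mono_right (Finset.filter_subset _ _), ?_⟩
    rw [← hF]
    exact Finset.disjoint_filter_filter_not _ _ _
  · intro x hx; exact Finset.mem_filter.1 hx
  · intro a ha
    rw [Finset.mem_union] at ha
    have iu := hs.isolated u hu
    have iv := hs.isolated v hv
    have new : ∀ u v, IsAddEdge G G' u v → (∀ y, ¬ G.Adj u y) → (∀ y, ¬ G.Adj v y) →
        ∀ c, Near G' u c → c = u ∨ c = v := by
      intro u v hadd hu hv c hc
      have hd := doubleStar_of_isolated hadd hu hv
      rcases hd.near_iff.1 hc with h | h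
      · rcases (hadd.2 u c).1 h with h | h | h
        · exact absurd h (hu c)
        · exact Or.inr h.2
        · exact absurd h.1 hadd.1
      · rcases (hadd.2 v c).1 h with h | h | h
        · exact absurd h (hv c)
        · exact absurd h.1.symm hadd.1
        · exact Or.inl h.2
    rcases ha with ha | ha
    · obtain ⟨b, hb, hbc⟩ := hs.star a ha
      have nu := hs.near_iff_of_isolated ha hu
      have nv := hs.near_iff_of_isolated ha hv
      obtain ⟨hb', hadj⟩ := hb.of_isAddEdge_of_not_near hadd nu nv
      refine ⟨b, hb', fun c hc hac => ?_⟩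
      rw [near_congr hb hb' (hadj c)] at hac
      simp only [Finset.mem_union, Finset.mem_insert, Finset.mem_singleton] at hc
      rcases hc with hc | rfl | rfl
      · exact hbc c hc hac
      · exact absurd hac nu
      · exact absurd hac nv
    · rw [Finset.mem_insert, Finset.mem_singleton] at ha
      rcases ha with rfl | rfl
      · exact ⟨v, doubleStar_of_isolated hadd iu iv, fun c _ => new _ _ hadd iu iv c⟩
      · exact ⟨u, doubleStar_of_isolated hadd.symm iv iu, fun c _ => new _ _ hadd.symm iv iu c⟩
  · intro hh z hz
    exact (hs.queue_bound hh z hz).of_isAddEdge hadd (hs.startBound_fresh hu)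
      (hs.startBound_fresh hv) (by norm_num)

/-- The centre gains a leaf and stays a centre. Paths through the new edge have at most 1 + 3
vertices, so the queue bound five survives without a hit. -/
lemma Sound.fresh_active (hs : Sound G X s) (hadd : IsAddEdge G G' u v) (hu : u ∈ s.fresh)
    (hv : v ∈ s.active) : Sound G' (X.erase s(u, v)) (makerStep G s s(u, v)) := by
  classical
  have hdu := Finset.disjoint_right.1 hs.disjoint_active_fresh hu
  have hdv := Finset.disjoint_left.1 hs.disjoint_active_fresh hv
  have hF : s.fresh.filter (· ∈ s(u, v)) = {u} := by
    ext x; simp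
    constructor
    · rintro ⟨h1, rfl | rfl⟩
      · rfl
      · exact absurd h1 hdv
    · rintro rfl; tauto
  have hstep : makerStep G s s(u, v) =
      { s with queue := s.queue ∪ {u}, fresh := s.fresh.filter (· ∉ s(u, v)) } := by
    unfold makerStep
    rw [if_neg (by simp [hdv]), if_pos (by simp [hu, hv])]
    simp only [← hF]
  rw [hstep]
  have iu := hs.isolated u hu
  refine hs.of_maker hadd rfl Finset.subset_union_left ?_ ?_ ?_ ?_ ?_ ?_ ?_
  · ext x
    simp only [GameState.mem_opened, Finset.mem_union, Finset.mem_filter,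
      Finset.mem_singleton, Sym2.mem_iff]
    by_cases h1 : x = u
    · subst h1; tauto
    · by_cases h2 : x = v
      · subst h2; tauto
      · tauto
  · rw [Finset.disjoint_union_left]
    exact ⟨hs.disjoint_queue_active, by simpa using hdu⟩
  · rw [Finset.disjoint_union_left]
    exact ⟨hs.disjoint_queue_fresh.mono_right (Finset.filter_subset _ _), by simp⟩
  · exact hs.disjoint_active_fresh.mono_right (Finset.filter_subset _ _)
  · intro x hx; exact Finset.mem_filter.1 hx
  · intro a ha
    simp only at ha
    obtain ⟨b, hb, hbc⟩ := hs.star a ha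
    have nu := hs.near_iff_of_isolated ha hu
    by_cases nv : Near G a v
    · have hab : DoubleStar G' a b := by
        rcases hbc v hv nv with rfl | rfl
        · exact hb.of_isAddEdge_leaf hadd iu
        · exact (hb.symm.of_isAddEdge_leaf hadd iu).symm
      refine ⟨b, hab, fun c hc hac => ?_⟩
      simp only at hc
      have hcu : c ≠ u := fun h => hdu (h ▸ hc)
      have : Near G a c := by
        have hx : ∀ w, G'.Adj w c → w = u ∨ G.Adj w c := by
          intro w hw
          rcases (hadd.2 w c).1 hw with h | h | h
          · exact Or.inr h
          · exact Or.inl h.1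
          · exact absurd h.2 hcu
        rw [hb.near_iff]
        rcases hab.near_iff.1 hac with h | h
        · rcases hx _ h with rfl | h
          · exact absurd ha hdu
          · exact Or.inl h
        · rcases hx _ h with rfl | h
          · exact absurd hb.1.symm (iu a)
          · exact Or.inr h
      exact hbc c hc this
    · obtain ⟨hb', hadj⟩ := hb.of_isAddEdge_of_not_near hadd nu nv
      refine ⟨b, hb', fun c hc hac => ?_⟩
      rw [near_congr hb hb' (hadj c)] at hac
      exact hbc c hc hac
  · intro hh z hz
    rw [Finset.mem_union, Finset.mem_singleton] at hz
    have hz5 : StartBound G z 5 := by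
      rcases hz with hz | rfl
      · exact hs.queue_bound hh z hz
      · exact (hs.startBound_fresh hu).mono (by norm_num)
    exact hz5.of_isAddEdge hadd (hs.startBound_fresh hu) (hs.startBound_active hv) (by norm_num)

/-- The components met by the edge lose their active status, so stars must be checked only in
untouched components. The queue bound matters only if there is no hit, and then both ends are
active. -/
lemma Sound.other (hs : Sound G X s) (hadd : IsAddEdge G G' u v)
    (h1 : ¬ ∀ x ∈ s(u, v), x ∈ s.fresh)
    (h2 : ¬ ((∀ x ∈ s(u, v), x ∈ s.fresh ∨ x ∈ s.active) ∧ ∃ x ∈ s(u, v), x ∈ s.fresh))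
    (hX : s(u, v) ∈ X) : Sound G' (X.erase s(u, v)) (makerStep G s s(u, v)) := by
  classical
  have hu := hs.mem_opened _ hX u (by simp)
  have hv := hs.mem_opened _ hX v (by simp)
  have haff : affected G s s(u, v) ⊆ s.active := Finset.filter_subset _ _
  unfold makerStep
  rw [if_neg h1, if_neg h2]
  refine hs.of_maker hadd rfl Finset.subset_union_left ?_ ?_ ?_ ?_ ?_ ?_ ?_
  · ext x
    simp only [GameState.mem_opened, Finset.mem_union, Finset.mem_filter, Finset.mem_sdiff]
    have := @haff x
    tauto
  · rw [Finset.disjoint_union_left, Finset.disjoint_union_left]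
    refine ⟨hs.disjoint_queue_active.mono_right Finset.sdiff_subset, Finset.disjoint_sdiff, ?_⟩
    exact hs.disjoint_active_fresh.symm.mono (Finset.filter_subset _ _) Finset.sdiff_subset
  · rw [Finset.disjoint_union_left, Finset.disjoint_union_left]
    refine ⟨hs.disjoint_queue_fresh.mono_right (Finset.filter_subset _ _),
      hs.disjoint_active_fresh.mono haff (Finset.filter_subset _ _), ?_⟩
    exact Finset.disjoint_filter_filter_not _ _ _
  · exact hs.disjoint_active_fresh.mono Finset.sdiff_subset (Finset.filter_subset _ _)
  · intro x hx; simpa using hx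
  · intro a ha
    rw [Finset.mem_sdiff] at ha
    obtain ⟨b, hb, hbc⟩ := hs.star a ha.1
    have nu : ¬ Near G a u := fun h => ha.2 (Finset.mem_filter.2 ⟨ha.1, u, by simp, h⟩)
    have nv : ¬ Near G a v := fun h => ha.2 (Finset.mem_filter.2 ⟨ha.1, v, by simp, h⟩)
    obtain ⟨hb', hadj⟩ := hb.of_isAddEdge_of_not_near hadd nu nv
    refine ⟨b, hb', fun c hc hac => ?_⟩
    rw [near_congr hb hb' (hadj c)] at hac
    exact hbc c (Finset.mem_sdiff.1 hc).1 hac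
  · intro hh z hz
    rw [not_or] at hh
    obtain ⟨hh, hnh⟩ := hh
    unfold IsHit at hnh
    rw [not_or] at hnh
    obtain ⟨hnq, hnr⟩ := hnh
    have hact : ∀ x ∈ s(u, v), x ∈ s.active := by
      by_contra hcon
      apply h2
      refine ⟨fun x hx => ?_, ?_⟩
      · rcases GameState.mem_opened.1 (hs.mem_opened _ hX x hx) with h | h | h
        · exact absurd ⟨x, hx, h⟩ hnq
        · exact Or.inr h
        · exact Or.inl h
      · push Not at hcon
        obtain ⟨x, hx, hxa⟩ := hcon
        refine ⟨x, hx, ?_⟩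
        rcases GameState.mem_opened.1 (hs.mem_opened _ hX x hx) with h | h | h
        · exact absurd ⟨x, hx, h⟩ hnq
        · exact absurd h hxa
        · exact h
    have hau := hact u (by simp)
    have hav := hact v (by simp)
    have hz' : z ∈ s.queue ∨ z ∈ s.active := by
      rw [Finset.mem_union, Finset.mem_union, Finset.mem_filter] at hz
      rcases hz with hz | hz | hz
      · exact Or.inl hz
      · exact Or.inr (haff hz)
      · exfalso
        exact Finset.disjoint_left.1 hs.disjoint_active_fresh (hact z hz.2) hz.1
    have hz5 : StartBound G z 5 := by
      rcases hz' with hz | hz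
      · exact hs.queue_bound hh z hz
      · exact (hs.startBound_active hz).mono (by norm_num)
    -- A queued vertex at distance two from an end would make the edge a hit; an active one in the
    -- same component is the other centre, which cannot be reached through a leaf.
    have hnear : ∀ w ∈ s(u, v), ∀ y, G.Adj w y → G.Adj y z → z = w := by
      intro w hw y hwy hyz
      by_contra hzw
      rcases hz' with hz | hz
      · exact hnr ⟨hact, w, hw, z, hz, hzw, y, hwy, hyz⟩
      · obtain ⟨b, hb, hbc⟩ := hs.star w (hact w hw)
        rcases hbc z hz (Or.inr (Or.inr ⟨y, hwy, hyz⟩)) with rfl | rfl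
        · exact hzw rfl
        · exact hzw (hb.2.1 y hwy hyz.ne z hyz)
    exact hz5.of_isAddEdge_of_near hadd (hs.startBound_active hau) (hs.startBound_active hav)
      (hnear u (by simp)) (hnear v (by simp))

lemma Sound.after_maker (hs : Sound G X s) (hadd : IsAddEdge G G' u v) (hX : s(u, v) ∈ X) :
    Sound G' (X.erase s(u, v)) (makerStep G s s(u, v)) := by
  by_cases h1 : ∀ x ∈ s(u, v), x ∈ s.fresh
  · exact hs.fresh_fresh hadd (h1 u (by simp)) (h1 v (by simp))
  by_cases h2 : (∀ x ∈ s(u, v), x ∈ s.fresh ∨ x ∈ s.active) ∧ ∃ x ∈ s(u, v), x ∈ s.fresh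
  · obtain ⟨h3, h4⟩ := h2
    have hu := h3 u (by simp)
    have hv := h3 v (by simp)
    simp only [Sym2.mem_iff, forall_eq_or_imp, forall_eq, exists_eq_or_imp, exists_eq_left]
      at h1 h4
    rcases hu with hu | hu
    · rcases hv with hv | hv
      · exact absurd ⟨hu, hv⟩ h1
      · exact hs.fresh_active hadd hu hv
    · have hv : v ∈ s.fresh := by
        rcases h4 with h4 | h4
        · exact absurd h4 (Finset.disjoint_left.1 hs.disjoint_active_fresh hu)
        · exact h4
      rw [Sym2.eq_swap]
      exact hs.fresh_active hadd.symm hv hu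
  · exact hs.other hadd h1 h2 hX

/-- Without a second hit, an end in the queue means that the queue had not been hit, so its bound
five is available; other ends have bound three or one. Hence 5 + 5 = 10. -/
lemma Sound.pathBound (hs : Sound G X s) (hadd : IsAddEdge G G' u v) (hX : s(u, v) ∈ X)
    (hG : PathBound G 10) (hh : ¬ (s.hit ∧ IsHit G s s(u, v))) : PathBound G' 10 := by
  have hb : ∀ x ∈ s(u, v), StartBound G x 5 := by
    intro x hx
    rcases GameState.mem_opened.1 (hs.mem_opened _ hX x hx) with h | h | h
    · exact hs.queue_bound (fun hhit => hh ⟨hhit, Or.inl ⟨x, hx, h⟩⟩) x h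
    · exact (hs.startBound_active h).mono (by norm_num)
    · exact (hs.startBound_fresh h).mono (by norm_num)
  exact hG.of_isAddEdge hadd (hb u (by simp)) (hb v (by simp)) (by norm_num)

/-! ### Breaker's half of a round -/

section Response

variable {b : ℕ} {S : Finset (Sym2 (Fin n))}

lemma rank_lt_of_mem_opened (hx : u ∈ s.opened) (hv : v ∉ s.opened) (hh : s.head ∈ s.queue) :
    s.rank u < s.rank v := by
  have hvh : v ≠ s.head := fun h => hv (GameState.mem_opened.2 (Or.inl (h ▸ hh)))
  rw [GameState.mem_opened] at hx hv
  simp only [not_or] at hv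
  have := u.2
  unfold rank
  rw [if_neg hvh, if_neg hv.1, if_neg hv.2.1, if_neg hv.2.2]
  split_ifs <;> first | omega | (exfalso; tauto)

/-- Closed vertices come last in the order; working at one would mean that all of `X`, more than `b`
edges, had been claimed. -/
lemma Sound.mem_opened_of_isResponse (hs : Sound G X s) (hb : b < X.card)
    (hr : IsResponse s X b (v, S)) : v ∈ s.opened := by
  by_contra hv
  have : X ⊆ S := by
    intro e he
    apply hr.2.2.1 e he
    induction e with
    | _ x y =>
      exact ⟨x, by simp, rank_lt_of_mem_opened (hs.mem_opened _ he x (by simp)) hv hs.head_mem⟩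
  have := Finset.card_le_card this
  rw [hr.2.1] at this
  omega

lemma rank_lt_of_mem_queue (hu : u ∈ s.queue) (hv : v ∉ s.queue) (hh : s.head ∈ s.queue) :
    s.rank u < s.rank v := by
  have hvh : v ≠ s.head := fun h => hv (h ▸ hh)
  have := u.2
  unfold rank
  rw [if_neg hvh, if_neg hv]
  split_ifs <;> first | omega

lemma mem_opened_advance (hv : v ∈ s.opened) {x : Fin n} :
    x ∈ (s.advance v).opened ↔ x ∈ s.opened ∧ s.rank v ≤ s.rank x := by
  simp only [GameState.mem_opened, advance, Finset.mem_insert, Finset.mem_filter]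
  rw [GameState.mem_opened] at hv
  by_cases hx : x = v
  · subst hx; simp [hv]
  · have : s.rank v ≤ s.rank x ↔ s.rank v < s.rank x := by
      rw [le_iff_lt_or_eq]
      constructor
      · rintro (h | h)
        · exact h
        · exact absurd (s.rank_injective h).symm hx
      · exact Or.inl
    rw [this]
    tauto

/-- If `v` comes from outside the queue, the old queue is exhausted and `{v}` is the new one; `v`
was active or fresh, so the bound five holds again and the hit can be forgotten. -/
lemma Sound.after_breaker (hs : Sound G X s) (hb : b < X.card) (hr : IsResponse s X b (v, S)) :
    Sound G (X \ S) (s.advance v) := by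
  have hv := hs.mem_opened_of_isResponse hb hr
  have hsub1 : (s.advance v).active ⊆ s.active := Finset.filter_subset _ _
  have hsub2 : (s.advance v).fresh ⊆ s.fresh := Finset.filter_subset _ _
  refine ⟨Finset.mem_insert_self _ _, ?_, ?_, hs.disjoint_active_fresh.mono hsub1 hsub2, ?_, ?_,
    ?_, ?_, ?_, ?_⟩
  · unfold GameState.advance
    rw [Finset.disjoint_insert_left]
    exact ⟨by simp, hs.disjoint_queue_active.mono (Finset.filter_subset _ _)
      (Finset.filter_subset _ _)⟩
  · unfold GameState.advance
    rw [Finset.disjoint_insert_left]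
    exact ⟨by simp, hs.disjoint_queue_fresh.mono (Finset.filter_subset _ _)
      (Finset.filter_subset _ _)⟩
  · exact fun x hx => hs.isolated x (hsub2 hx)
  · intro a ha
    obtain ⟨c, hc, hcd⟩ := hs.star a (hsub1 ha)
    exact ⟨c, hc, fun d hd => hcd d (hsub1 hd)⟩
  · intro hh z hz
    unfold GameState.advance at hz hh
    rw [Finset.mem_insert, Finset.mem_filter] at hz
    by_cases hvq : v ∈ s.queue
    · have hh' : ¬ s.hit := fun h => hh ⟨h, hvq⟩
      rcases hz with rfl | hz
      · exact hs.queue_bound hh' z hvq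
      · exact hs.queue_bound hh' z hz.1
    · rcases hz with rfl | hz
      · rcases GameState.mem_opened.1 hv with h | h | h
        · exact absurd h hvq
        · exact (hs.startBound_active h).mono (by norm_num)
        · exact (hs.startBound_fresh h).mono (by norm_num)
      · exact absurd hz.2 (rank_lt_of_mem_queue hz.1 hvq hs.head_mem).not_gt
  · intro e he x hx
    rw [Finset.mem_sdiff] at he
    rw [mem_opened_advance hv]
    refine ⟨hs.mem_opened e he.1 x hx, ?_⟩
    by_contra hlt
    exact he.2 (hr.2.2.1 e he.1 ⟨x, hx, not_le.1 hlt⟩)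
  · intro x y hxy
    exact hs.not_adj x y (Finset.mem_sdiff.1 hxy).1
  · intro x hx y hy hxy hxv hyv
    have hlt : ∀ w, w ∈ (s.advance v).opened → w ≠ v → s.rank v < s.rank w := by
      intro w hw hwv
      refine lt_of_le_of_ne ((mem_opened_advance hv).1 hw).2 fun h => hwv ?_
      exact (s.rank_injective h).symm
    have hhead : ∀ w, s.rank v < s.rank w → w ≠ s.head := by
      rintro w hw rfl
      have : s.rank s.head = 0 := by simp [rank]
      omega
    have hx' := hlt x hx hxv
    have hy' := hlt y hy hyv
    rcases hs.complete x ((mem_opened_advance hv).1 hx).1 y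
      ((mem_opened_advance hv).1 hy).1 hxy (hhead x hx') (hhead y hy') with h | h
    · left
      refine Finset.mem_sdiff.2 ⟨h, fun hS => ?_⟩
      obtain ⟨w, hw, hwv⟩ := hr.2.2.2 _ hS
      rw [Sym2.mem_iff] at hw
      simp only at hwv
      rcases hw with rfl | rfl <;> omega
    · exact Or.inr h

end Response

end GameState

end MakerBreaker

namespace MakerBreaker

namespace GameState

variable {n : ℕ}

/-! ### Counting unclaimed edges -/

/-- The number of edges of `X` that touch the vertex set `Z`. -/
def touching (X : Finset (Sym2 (Fin n))) (Z : Finset (Fin n)) : ℕ :=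
  (X.filter fun e => ∃ x ∈ e, x ∈ Z).card

lemma touching_mono {X Y : Finset (Sym2 (Fin n))} {Z W : Finset (Fin n)} (hX : X ⊆ Y)
    (hZ : Z ⊆ W) : touching X Z ≤ touching Y W := by
  apply Finset.card_le_card
  intro e he
  rw [Finset.mem_filter] at he ⊢
  obtain ⟨h1, x, hx, hxZ⟩ := he
  exact ⟨hX h1, x, hx, hZ hxZ⟩

lemma touching_union_le (X : Finset (Sym2 (Fin n))) (Z W : Finset (Fin n)) :
    touching X (Z ∪ W) ≤ touching X Z + touching X W := by
  unfold touching
  refine le_trans (Finset.card_le_card ?_) (Finset.card_union_le _ _)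
  intro e he
  simp only [Finset.mem_union, Finset.mem_filter] at he ⊢
  obtain ⟨h1, x, hx, h | h⟩ := he
  · exact Or.inl ⟨h1, x, hx, h⟩
  · exact Or.inr ⟨h1, x, hx, h⟩

variable {G G' : SimpleGraph (Fin n)} {X : Finset (Sym2 (Fin n))} {s s₁ : GameState n}
  {u v : Fin n}

lemma Sound.touching_singleton_le (hs : Sound G X s) (x : Fin n) :
    touching X {x} ≤ s.opened.card := by
  unfold touching
  refine le_trans (Finset.card_le_card (t := s.opened.image fun y => s(x, y)) ?_)
    Finset.card_image_le
  intro e he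
  rw [Finset.mem_filter] at he
  obtain ⟨h1, y, hy, h2⟩ := he
  rw [Finset.mem_singleton] at h2
  subst h2
  obtain ⟨z, rfl⟩ := Sym2.mem_iff_exists.1 hy
  exact Finset.mem_image.2 ⟨z, hs.mem_opened _ h1 z (by simp), rfl⟩

lemma Sound.touching_le (hs : Sound G X s) (Z : Finset (Fin n)) :
    touching X Z ≤ Z.card * s.opened.card := by
  induction Z using Finset.induction_on with
  | empty => simp [touching]
  | insert a Z ha ih =>
    rw [Finset.card_insert_of_notMem ha, Finset.insert_eq, add_mul, one_mul]
    have := touching_union_le X {a} Z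
    have := hs.touching_singleton_le a
    omega

lemma Sound.card_le (hs : Sound G X s) : X.card ≤ s.opened.card.choose 2 := by
  rw [← Sym2.card_image_offDiag]
  apply Finset.card_le_card
  intro e he
  induction e with
  | _ x y =>
    rw [Finset.mem_image]
    exact ⟨(x, y), Finset.mem_offDiag.2 ⟨hs.mem_opened _ he x (by simp),
      hs.mem_opened _ he y (by simp), (hs.not_adj x y he).1⟩, rfl⟩

/-- Away from the head, Breaker owns no edge between open vertices. So few unclaimed edges force few
open vertices. -/
lemma Sound.choose_le (hs : Sound G X s) {M : Finset (Sym2 (Fin n))}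
    (hM : ∀ x y, G.Adj x y → s(x, y) ∈ M) :
    (s.opened.card - 1).choose 2 ≤ X.card + M.card := by
  rw [← Finset.card_erase_of_mem (GameState.mem_opened.2 (Or.inl hs.head_mem)),
    ← Sym2.card_image_offDiag]
  refine le_trans (Finset.card_le_card ?_) (Finset.card_union_le X M)
  intro e he
  rw [Finset.mem_image] at he
  obtain ⟨⟨x, y⟩, hxy, rfl⟩ := he
  simp only [Finset.mem_offDiag, Finset.mem_erase] at hxy
  rw [Finset.mem_union]
  rcases hs.complete x hxy.1.2 y hxy.2.1.2 hxy.2.2 hxy.1.1 hxy.2.1.1 with h | h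
  · exact Or.inl h
  · exact Or.inr (hM x y h)

lemma Sound.choose_fresh_le (hs : Sound G X s) :
    s.fresh.card.choose 2 ≤ (X.filter fun e => ∀ x ∈ e, x ∈ s.fresh).card := by
  rw [← Sym2.card_image_offDiag]
  apply Finset.card_le_card
  intro e he
  rw [Finset.mem_image] at he
  obtain ⟨⟨x, y⟩, hxy, rfl⟩ := he
  simp only [Finset.mem_offDiag] at hxy
  have hne : ∀ w ∈ s.fresh, w ≠ s.head := by
    rintro w hw rfl
    exact Finset.disjoint_left.1 hs.disjoint_queue_fresh hs.head_mem hw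
  have ho : ∀ w ∈ s.fresh, w ∈ s.opened := fun w hw => GameState.mem_opened.2 (Or.inr (Or.inr hw))
  rw [Finset.mem_filter]
  refine ⟨?_, ?_⟩
  · rcases hs.complete x (ho x hxy.1) y (ho y hxy.2.1) hxy.2.2 (hne x hxy.1) (hne y hxy.2.1)
      with h | h
    · exact h
    · exact absurd h (hs.isolated x hxy.1 y)
  · simp [hxy.1, hxy.2.1]

/-! ### Total cost and number of hits -/

/-- The number of vertices, up to an upper bound, that join the queue when Maker claims `e`. -/
def cost (s : GameState n) (e : Sym2 (Fin n)) : ℕ :=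
  if ∀ x ∈ e, x ∈ s.fresh then 0
  else if (∀ x ∈ e, x ∈ s.fresh ∨ x ∈ s.active) ∧ ∃ x ∈ e, x ∈ s.fresh then 1
  else 4

lemma cost_le_four (s : GameState n) (e : Sym2 (Fin n)) : s.cost e ≤ 4 := by
  unfold cost; split_ifs <;> omega

lemma card_filter_mem_sym2_le (F : Finset (Fin n)) (e : Sym2 (Fin n)) :
    (F.filter (· ∈ e)).card ≤ 2 := by
  induction e with
  | _ u v =>
    refine le_trans (Finset.card_le_card (t := {u, v}) ?_) Finset.card_le_two
    intro x hx
    simpa using (Finset.mem_filter.1 hx).2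

/-- Each new queue vertex brings at most `s.opened.card` unclaimed edges. In the last case each end
brings at most two vertices: a component has at most two active vertices, and a fresh end lies in
none of their components. -/
lemma Sound.touching_makerStep_le (hs : Sound G X s) (hX : s(u, v) ∈ X) :
    touching (X.erase s(u, v)) (makerStep G s s(u, v)).queue ≤
      touching X s.queue + s.cost s(u, v) * s.opened.card := by
  classical
  have aux : ∀ (N : Finset (Fin n)) (k : ℕ), N.card ≤ k →
      touching (X.erase s(u, v)) (s.queue ∪ N) ≤ touching X s.queue + k * s.opened.card := by
    intro N k hN
    refine (touching_union_le _ _ _).trans ?_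
    have h1 := touching_mono (Finset.erase_subset s(u, v) X) (Finset.Subset.refl s.queue)
    have h2 := touching_mono (Finset.erase_subset s(u, v) X) (Finset.Subset.refl N)
    have h3 := hs.touching_le N
    have h4 := Nat.mul_le_mul_right s.opened.card hN
    omega
  unfold makerStep cost
  by_cases h1 : ∀ x ∈ s(u, v), x ∈ s.fresh
  · rw [if_pos h1, if_pos h1]
    have := aux ∅ 0 (by simp)
    simpa using this
  rw [if_neg h1, if_neg h1]
  by_cases h2 : (∀ x ∈ s(u, v), x ∈ s.fresh ∨ x ∈ s.active) ∧ ∃ x ∈ s(u, v), x ∈ s.fresh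
  · rw [if_pos h2, if_pos h2]
    refine aux (s.fresh.filter (· ∈ s(u, v))) 1 ?_
    rw [Finset.card_le_one]
    intro x hx y hy
    rw [Finset.mem_filter, Sym2.mem_iff] at hx hy
    simp only [Sym2.mem_iff, forall_eq_or_imp, forall_eq] at h1
    by_contra hne
    rcases hx with ⟨hx, rfl | rfl⟩ <;> rcases hy with ⟨hy, rfl | rfl⟩ <;> tauto
  · rw [if_neg h2, if_neg h2]
    refine aux _ 4 ?_
    have hone : ∀ x, (s.active.filter (Near G · x) ∪ s.fresh.filter (· = x)).card ≤ 2 := by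
      intro x
      by_cases hx : x ∈ s.fresh
      · have : s.active.filter (Near G · x) = ∅ := by
          rw [Finset.filter_eq_empty_iff]
          exact fun a ha => hs.near_iff_of_isolated ha hx
        rw [this, Finset.empty_union, Finset.filter_eq', if_pos hx]
        simp
      · have : s.fresh.filter (· = x) = ∅ := by
          rw [Finset.filter_eq', if_neg hx]
        rw [this, Finset.union_empty]
        by_cases hne : (s.active.filter (Near G · x)).Nonempty
        · obtain ⟨a, ha⟩ := hne
          rw [Finset.mem_filter] at ha
          obtain ⟨b, hb, hbc⟩ := hs.star a ha.1
          refine le_trans (Finset.card_le_card (t := {a, b}) ?_) Finset.card_le_two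
          intro c hc
          rw [Finset.mem_filter] at hc
          rw [Finset.mem_insert, Finset.mem_singleton]
          apply hbc c hc.1
          rcases hc.2 with rfl | h | ⟨y, hcy, hyx⟩
          · exact ha.2
          · exact hb.near_of_near ha.2 h.symm
          · exact hb.near_of_near (hb.near_of_near ha.2 hyx.symm) hcy.symm
        · rw [Finset.not_nonempty_iff_eq_empty.1 hne]; simp
    refine le_trans (Finset.card_le_card (t := (s.active.filter (Near G · u) ∪
      s.fresh.filter (· = u)) ∪ (s.active.filter (Near G · v) ∪ s.fresh.filter (· = v))) ?_) ?_
    · intro x hx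
      simp only [affected, Finset.mem_union, Finset.mem_filter, Sym2.mem_iff, exists_eq_or_imp,
        exists_eq_left] at hx ⊢
      tauto
    · refine (Finset.card_union_le _ _).trans ?_
      have := hone u
      have := hone v
      omega

/-- Charge one to every edge, refund it inside the fresh set, and add three for edges inside the
active set or at the queue. All fresh pairs are unclaimed, so the refund is a full binomial
coefficient. -/
lemma Sound.sum_cost_le (hs : Sound G X s) :
    ∑ e ∈ X, s.cost e + s.fresh.card.choose 2 ≤
      X.card + 3 * (s.active.card.choose 2 + touching X s.queue) := by
  have h1 := hs.choose_fresh_le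
  have hpt : ∀ e ∈ X, s.cost e + (if ∀ x ∈ e, x ∈ s.fresh then 1 else 0) ≤
      1 + (if ∀ x ∈ e, x ∈ s.active then 3 else 0) + (if ∃ x ∈ e, x ∈ s.queue then 3 else 0) := by
    intro e he
    unfold cost
    by_cases h1 : ∀ x ∈ e, x ∈ s.fresh
    · rw [if_pos h1, if_pos h1]; omega
    rw [if_neg h1, if_neg h1]
    split_ifs with h2 h3 h4 h4 h3 h4 h4 <;> try omega
    exfalso
    apply h2
    have hfa : ∀ x ∈ e, x ∈ s.fresh ∨ x ∈ s.active := by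
      intro x hx
      rcases GameState.mem_opened.1 (hs.mem_opened e he x hx) with h | h | h
      · exact absurd ⟨x, hx, h⟩ h4
      · exact Or.inr h
      · exact Or.inl h
    refine ⟨hfa, ?_⟩
    push Not at h3
    obtain ⟨x, hx, hxa⟩ := h3
    exact ⟨x, hx, (hfa x hx).resolve_right hxa⟩
  have hsum := Finset.sum_le_sum hpt
  simp only [Finset.sum_add_distrib, ← Finset.sum_filter, Finset.sum_const, smul_eq_mul,
    mul_one] at hsum
  have hA : (X.filter fun e => ∀ x ∈ e, x ∈ s.active).card ≤ s.active.card.choose 2 := by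
    rw [← Sym2.card_image_offDiag]
    apply Finset.card_le_card
    intro e he
    rw [Finset.mem_filter] at he
    induction e with
    | _ x y =>
      rw [Finset.mem_image]
      exact ⟨(x, y), Finset.mem_offDiag.2 ⟨he.2 x (by simp), he.2 y (by simp),
        (hs.not_adj x y he.1).1⟩, rfl⟩
  have hQ : (X.filter fun e => ∃ x ∈ e, x ∈ s.queue).card = touching X s.queue := rfl
  omega

lemma sum_touching_singleton_le (X : Finset (Sym2 (Fin n))) (Z : Finset (Fin n)) :
    ∑ z ∈ Z, touching X {z} ≤ 2 * touching X Z := by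
  have h1 : ∀ z, touching X {z} = ∑ e ∈ X, if z ∈ e then 1 else 0 := by
    intro z
    rw [touching, Finset.card_filter]
    simp
  simp only [h1]
  rw [Finset.sum_comm, touching, Finset.card_filter, Finset.mul_sum]
  apply Finset.sum_le_sum
  intro e _
  rw [← Finset.card_filter]
  split_ifs with h
  · simpa using card_filter_mem_sym2_le Z e
  · rw [Finset.filter_eq_empty_iff.2]
    · simp
    · exact fun z hz hze => h ⟨z, hze, hz⟩

open Classical in
-- Hits that avoid the queue have an end in `R`, the active vertices with a queued vertex at
-- distance two. That vertex is a leaf, and if it is not the head, almost all its edges to open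
-- vertices are unclaimed, so `R` is small compared with the load.
lemma Sound.card_hit_le (hs : Sound G X s) (ho : 9 ≤ s.opened.card) :
    (X.filter fun e => IsHit G s e).card ≤ 4 * touching X s.queue + s.opened.card := by
  set R := s.active.filter fun a => ∃ z ∈ s.queue, z ≠ a ∧ ∃ y, G.Adj a y ∧ G.Adj y z with hR
  set L := s.queue.filter fun z => z ≠ s.head ∧ ∃ y, ∀ w, G.Adj z w → w = y with hL
  have h1 : (X.filter fun e => IsHit G s e).card ≤ touching X s.queue + touching X R := by
    refine le_trans (Finset.card_le_card ?_) (Finset.card_union_le _ _)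
    intro e he
    rw [Finset.mem_filter] at he
    rw [Finset.mem_union, Finset.mem_filter, Finset.mem_filter]
    rcases he.2 with h | ⟨h2, x, hx, h3⟩
    · exact Or.inl ⟨he.1, h⟩
    · exact Or.inr ⟨he.1, x, hx, Finset.mem_filter.2 ⟨h2 x hx, h3⟩⟩
  have h2 : R.card ≤ L.card + 1 := by
    have hex : ∀ a ∈ R, ∃ z ∈ s.queue, z ≠ a ∧ ∃ b, DoubleStar G a b ∧
        (∀ c ∈ s.active, Near G a c → c = a ∨ c = b) ∧ G.Adj b z ∧ ∀ w, G.Adj z w → w = b := by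
      intro a ha
      rw [hR, Finset.mem_filter] at ha
      obtain ⟨ha, z, hz, hza, y, hay, hyz⟩ := ha
      obtain ⟨b, hb, hbc⟩ := hs.star a ha
      have hyb : y = b := by
        by_contra hyb
        exact hza (hb.2.1 y hay hyb z hyz)
      subst hyb
      exact ⟨z, hz, hza, y, hb, hbc, hyz, hb.2.2 z hyz hza⟩
    choose! f hf using hex
    -- A leaf determines its neighbour, and that centre determines the active centre opposite.
    have hinj : Set.InjOn f R := by
      intro a ha c hc hac
      obtain ⟨-, -, b, hb, hbc, hbz, hz⟩ := hf a ha
      obtain ⟨-, -, d, hd, -, hdz, -⟩ := hf c hc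
      rw [← hac] at hdz
      obtain rfl := hz d hdz.symm
      rcases hbc c (Finset.mem_filter.1 hc).1 (Or.inr (Or.inr ⟨d, hb.1, hd.1.symm⟩)) with h | h
      · exact h.symm
      · exact absurd h hd.1.ne
    rw [← Finset.card_image_of_injOn hinj]
    refine le_trans (Finset.card_le_card (t := insert s.head L) ?_) (Finset.card_insert_le _ _)
    intro z hz
    obtain ⟨a, ha, rfl⟩ := Finset.mem_image.1 hz
    obtain ⟨h3, -, b, -, -, -, h4⟩ := hf a ha
    rw [Finset.mem_insert, hL, Finset.mem_filter]
    by_cases hh : f a = s.head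
    · exact Or.inl hh
    · exact Or.inr ⟨h3, hh, b, h4⟩
  have h3 : L.card * (s.opened.card - 3) ≤ 2 * touching X s.queue := by
    have hdeg : ∀ z ∈ L, s.opened.card - 3 ≤ touching X {z} := by
      intro z hz
      rw [hL, Finset.mem_filter] at hz
      obtain ⟨hzq, hzh, y, hy⟩ := hz
      have hsub : ((s.opened \ {z, s.head, y}).image fun w => s(z, w)) ⊆
          X.filter fun e => ∃ x ∈ e, x ∈ ({z} : Finset (Fin n)) := by
        intro e he
        obtain ⟨w, hw, rfl⟩ := Finset.mem_image.1 he
        simp only [Finset.mem_sdiff, Finset.mem_insert, Finset.mem_singleton, not_or] at hw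
        rw [Finset.mem_filter]
        refine ⟨?_, z, by simp, by simp⟩
        rcases hs.complete z (GameState.mem_opened.2 (Or.inl hzq)) w hw.1 (Ne.symm hw.2.1) hzh
          hw.2.2.1 with h | h
        · exact h
        · exact absurd (hy w h) hw.2.2.2
      have h4 := Finset.card_le_card hsub
      rw [Finset.card_image_of_injective _ (fun a b hab => Sym2.congr_right.1 hab)] at h4
      have h5 := Finset.le_card_sdiff {z, s.head, y} s.opened
      have h6 : ({z, s.head, y} : Finset (Fin n)).card ≤ 3 := Finset.card_le_three
      unfold touching
      omega
    calc L.card * (s.opened.card - 3) ≤ ∑ z ∈ L, touching X {z} := by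
          simpa using Finset.card_nsmul_le_sum L _ _ hdeg
      _ ≤ 2 * touching X L := sum_touching_singleton_le X L
      _ ≤ 2 * touching X s.queue :=
          Nat.mul_le_mul_left _ (touching_mono (Finset.Subset.refl _) (Finset.filter_subset _ _))
  have h4 := hs.touching_le R
  have h5 : R.card * s.opened.card ≤ (L.card + 1) * s.opened.card := Nat.mul_le_mul_right _ h2
  -- From nine open vertices on, the number `o` of them satisfies `o ≤ 3(o - 3)/2`, so `L` accounts
  -- for at most three times the load.
  obtain ⟨k, hk⟩ : ∃ k, s.opened.card = k + 9 := ⟨s.opened.card - 9, by omega⟩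
  rw [hk] at h3 h4 h5 ⊢
  have h6 : k + 9 - 3 = k + 6 := by omega
  rw [h6] at h3
  nlinarith

/-! ### The effect of Breaker's answer -/

section Response

variable {b : ℕ} {S : Finset (Sym2 (Fin n))}

/-- As long as work stays inside the queue, all `b` claimed edges touch it. -/
lemma Sound.touching_advance_add_le (hs : Sound G X s) (hr : IsResponse s X b (v, S))
    (hv : v ∈ s.queue) :
    touching (X \ S) (s.advance v).queue + b ≤ touching X s.queue := by
  have hq : (s.advance v).queue ⊆ s.queue := by
    unfold GameState.advance
    exact Finset.insert_subset hv (Finset.filter_subset _ _)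
  have hS : S ⊆ X.filter fun e => ∃ x ∈ e, x ∈ s.queue := by
    intro e he
    obtain ⟨x, hx, hxv⟩ := hr.2.2.2 e he
    refine Finset.mem_filter.2 ⟨hr.1 he, x, hx, ?_⟩
    by_contra hxq
    exact absurd (rank_lt_of_mem_queue hv hxq hs.head_mem) hxv.not_gt
  have h1 : touching (X \ S) (s.advance v).queue ≤
      ((X.filter fun e => ∃ x ∈ e, x ∈ s.queue) \ S).card := by
    refine (touching_mono (Finset.Subset.refl _) hq).trans (Finset.card_le_card ?_)
    intro e he
    simp only [Finset.mem_filter, Finset.mem_sdiff] at he ⊢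
    tauto
  rw [Finset.card_sdiff_of_subset hS] at h1
  have h2 := Finset.card_le_card hS
  have h3 : S.card = b := hr.2.1
  unfold touching at h1 h2 ⊢
  omega

lemma Sound.queue_advance (hs : Sound G X s) (hv : v ∉ s.queue) :
    (s.advance v).queue = {v} := by
  unfold GameState.advance
  simp only
  rw [Finset.filter_eq_empty_iff.2 fun x hx =>
    (rank_lt_of_mem_queue hx hv hs.head_mem).not_gt]
  rfl

lemma opened_advance_subset (hv : v ∈ s.opened) : (s.advance v).opened ⊆ s.opened :=
  fun _ hx => ((mem_opened_advance hv).1 hx).1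

/-- Fresh vertices are closed last: once one of them is reached, nothing but `v` and fresh vertices
is open. -/
lemma Sound.card_fresh_advance (hs : Sound G X s) (hv : v ∈ s.opened) :
    (s.advance v).fresh = s.fresh ∨
      (s.advance v).opened.card ≤ (s.advance v).fresh.card + 1 := by
  have hhead : ∀ w ∈ s.fresh, w ≠ s.head ∧ w ∉ s.queue ∧ w ∉ s.active := by
    intro w hw
    refine ⟨?_, Finset.disjoint_right.1 hs.disjoint_queue_fresh hw,
      Finset.disjoint_right.1 hs.disjoint_active_fresh hw⟩
    rintro rfl
    exact Finset.disjoint_left.1 hs.disjoint_queue_fresh hs.head_mem hw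
  have hfr : ∀ w ∈ s.fresh, s.rank w = 1 + 2 * n + w := by
    intro w hw
    obtain ⟨h1, h2, h3⟩ := hhead w hw
    unfold rank
    rw [if_neg h1, if_neg h2, if_neg h3, if_pos hw]
  have hnf : ∀ w ∈ s.opened, w ∉ s.fresh → s.rank w < 1 + 2 * n := by
    intro w hw hwf
    have := w.2
    rw [GameState.mem_opened] at hw
    unfold rank
    split_ifs <;> first | omega | (exfalso; tauto)
  by_cases hvf : v ∈ s.fresh
  · right
    have hA : (s.advance v).active = ∅ := by
      unfold GameState.advance
      simp only
      rw [Finset.filter_eq_empty_iff]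
      intro x hx
      have h1 := hnf x (GameState.mem_opened.2 (Or.inr (Or.inl hx)))
        (Finset.disjoint_left.1 hs.disjoint_active_fresh hx)
      have h2 := hfr v hvf
      omega
    rw [opened, hs.queue_advance (hhead v hvf).2.1, hA, Finset.union_empty]
    refine (Finset.card_union_le _ _).trans ?_
    rw [Finset.card_singleton]
    omega
  · left
    unfold GameState.advance
    simp only
    rw [Finset.filter_true_of_mem]
    intro x hx
    have h1 := hnf v hv hvf
    have h2 := hfr x hx
    omega

end Response

lemma card_fresh_makerStep (G : SimpleGraph (Fin n)) (s : GameState n) (e : Sym2 (Fin n)) :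
    s.fresh.card ≤ (makerStep G s e).fresh.card + 2 := by
  have h1 : (makerStep G s e).fresh = s.fresh.filter (· ∉ e) := by
    unfold makerStep
    split_ifs <;> rfl
  have h2 := card_filter_mem_sym2_le s.fresh e
  have h3 := Finset.card_filter_add_card_filter_not (s := s.fresh) (fun x => x ∈ e)
  rw [h1]
  omega

lemma hit_makerStep {G : SimpleGraph (Fin n)} {s : GameState n} {e : Sym2 (Fin n)}
    (h : (makerStep G s e).hit) : s.hit ∨ IsHit G s e := by
  unfold makerStep at h
  split_ifs at h
  · exact Or.inl h
  · exact Or.inl h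
  · exact h

lemma hit_makerStep_of_hit (G : SimpleGraph (Fin n)) {s : GameState n} (e : Sym2 (Fin n))
    (h : s.hit) : (makerStep G s e).hit := by
  unfold makerStep
  split_ifs
  · exact h
  · exact h
  · exact Or.inl h

lemma opened_makerStep (G : SimpleGraph (Fin n)) (s : GameState n) (e : Sym2 (Fin n)) :
    (makerStep G s e).opened = s.opened := by
  classical
  have haff : affected G s e ⊆ s.active := Finset.filter_subset _ _
  unfold makerStep
  ext x
  have := @haff x
  split_ifs <;> simp only [GameState.mem_opened, Finset.mem_union, Finset.mem_filter,
    Finset.mem_sdiff] <;> tauto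

end GameState

end MakerBreaker

namespace MakerBreaker

open GameState

/-! ### The strategy -/

section Strategy

variable {n : ℕ}

lemma free_cons {α : Type*} [DecidableEq α] (X : Finset α) (r : α × Finset α) (h : History α) :
    free X (r :: h) = (free X h).erase r.1 \ r.2 := by
  ext x
  simp only [free, makerSet, breakerSet, Finset.mem_sdiff, Finset.mem_union, Finset.mem_insert,
    Finset.mem_erase]
  tauto

lemma mem_completeBoard {x y : Fin n} : s(x, y) ∈ completeBoard n ↔ x ≠ y := by
  simp [completeBoard]

lemma isAddEdge_makerGraph {u v : Fin n} (huv : u ≠ v) (S : Finset (Sym2 (Fin n)))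
    (h : History (Sym2 (Fin n))) :
    IsAddEdge (makerGraph h) (makerGraph ((s(u, v), S) :: h)) u v := by
  refine ⟨huv, fun x y => ?_⟩
  simp only [makerGraph, makerSet, SimpleGraph.fromEdgeSet_adj, Finset.coe_insert,
    Set.mem_insert_iff, Sym2.eq_iff, Finset.mem_coe]
  constructor
  · tauto
  · rintro (h | ⟨rfl, rfl⟩ | ⟨rfl, rfl⟩)
    · tauto
    · exact ⟨by tauto, huv⟩
    · exact ⟨by tauto, huv.symm⟩

lemma makerGraph_nil_adj (x y : Fin n) : ¬ (makerGraph ([] : History (Sym2 (Fin n)))).Adj x y := by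
  simp [makerGraph, makerSet]

lemma free_nil : free (completeBoard n) [] = completeBoard n := by
  simp [free, makerSet, breakerSet]

lemma card_completeBoard (n : ℕ) : (completeBoard n).card = n.choose 2 := by
  rw [completeBoard, SimpleGraph.card_edgeFinset_top_eq_card_choose_two, Fintype.card_fin]

lemma adj_mem_makerSet {h : History (Sym2 (Fin n))} (x y : Fin n) (hxy : (makerGraph h).Adj x y) :
    s(x, y) ∈ makerSet h := by
  simpa using ((SimpleGraph.fromEdgeSet_adj _).1 hxy).1

/-- Covers the rounds in which Breaker closes fresh vertices: at most about `n` edges disappear per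
round, so after `t` rounds the remaining ones need at least `n - 2t` vertices to live on. -/
lemma fresh_bound_of_choose_le {n f t b E : ℕ} (hbn : b ≤ n)
    (h1 : E + t * (b + 1) = n.choose 2) (h2 : E ≤ (f + 1).choose 2) : n ≤ f + 1 + 2 * t := by
  by_contra! hlt
  have h3 : 2 * n.choose 2 = n * (n - 1) := by
    rw [Nat.choose_two_right, Nat.mul_div_cancel' (Nat.even_mul_pred_self n).two_dvd]
  have h4 : 2 * (f + 1).choose 2 = (f + 1) * f := by
    rw [Nat.choose_two_right, Nat.mul_div_cancel' (Nat.even_mul_pred_self _).two_dvd]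
    simp
  obtain ⟨d, rfl⟩ : ∃ d, n = f + 1 + 2 * t + (d + 1) := ⟨n - (f + 1 + 2 * t) - 1, by omega⟩
  have h5 : f + 1 + 2 * t + (d + 1) - 1 = f + 1 + 2 * t + d := by omega
  rw [h5] at h3
  have h6 : t * (b + 1) ≤ t * (f + 1 + 2 * t + (d + 1) + 1) := Nat.mul_le_mul_left _ (by omega)
  have h7 : (f + 1 + 2 * t + (d + 1)) * (f + 1 + 2 * t + d) ≤
      (f + 1) * f + 2 * (t * (f + 1 + 2 * t + (d + 1) + 1)) := by omega
  nlinarith [Nat.zero_le (d * t), Nat.zero_le (d * f), Nat.zero_le (f * t)]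

variable [NeZero n]

/-- The state at the beginning of the game. -/
def initialState (n : ℕ) [NeZero n] : GameState n where
  queue := {0}
  active := ∅
  fresh := Finset.univ.erase 0
  head := 0
  hit := False

/-- The state after the rounds of a history, if Breaker plays as proposed by `response`. -/
noncomputable def stateAfter (b : ℕ) : History (Sym2 (Fin n)) → GameState n
  | [] => initialState n
  | r :: h => ((makerStep (makerGraph h) (stateAfter b h) r.1).response
      ((free (completeBoard n) h).erase r.1) b).2

/-- Breaker closes the vertices one after the other, in the order given by `rank`. -/
noncomputable def closingStrategy (n b : ℕ) [NeZero n] : BreakerStrategy (completeBoard n) b where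
  move h e := ((makerStep (makerGraph h) (stateAfter b h) e).response
    ((free (completeBoard n) h).erase e) b).1
  move_subset _ _ _ := response_subset _ _ _
  card_move _ _ _ := card_response _ _ _

/-! ### Invariants along a play -/

/-- The invariants of a game that is not over yet. -/
structure Playing (b : ℕ) (h : History (Sym2 (Fin n))) : Prop where
  sound : Sound (makerGraph h) (free (completeBoard n) h) (stateAfter b h)
  card_free : (free (completeBoard n) h).card + h.length * (b + 1) = n.choose 2
  card_fresh : n ≤ (stateAfter b h).fresh.card + 1 + 2 * h.length
  card_maker : (makerSet h).card ≤ h.length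

/-- The invariants of a game that Maker has not won so far. -/
def Safe (b : ℕ) (h : History (Sym2 (Fin n))) : Prop :=
  PathBound (makerGraph h) 10 ∧ (free (completeBoard n) h = ∅ ∨ Playing b h)

lemma safe_nil (b : ℕ) : Safe b ([] : History (Sym2 (Fin n))) := by
  have hiso : ∀ v, StartBound (makerGraph ([] : History (Sym2 (Fin n)))) v 1 :=
    fun v => startBound_one_of_isolated (makerGraph_nil_adj v)
  refine ⟨?_, Or.inr ⟨?_, ?_, ?_, by simp [makerSet]⟩⟩
  · intro l hl
    cases l with
    | nil => simp
    | cons a l =>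
      have := hiso a l hl
      rw [List.length_cons]
      omega
  · have ho : ∀ x, x ∈ (initialState n).opened := by
      intro x
      simp [GameState.mem_opened, initialState]
      tauto
    refine ⟨by simp [stateAfter, initialState], by simp [stateAfter, initialState],
      by simp [stateAfter, initialState], by simp [stateAfter, initialState],
      fun x _ => makerGraph_nil_adj x, by simp [stateAfter, initialState],
      fun _ z _ => (hiso z).mono (by norm_num), fun e _ x _ => ho x, ?_, ?_⟩
    · intro x y hxy
      rw [free_nil, mem_completeBoard] at hxy
      exact ⟨hxy, makerGraph_nil_adj x y⟩
    · intro x _ y _ hxy _ _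
      left
      rw [free_nil, mem_completeBoard]
      exact hxy
  · rw [free_nil, card_completeBoard]; simp
  · have : 0 < n := Nat.pos_of_ne_zero (NeZero.ne n)
    simp [stateAfter, initialState]
    omega

variable {b : ℕ} {h : History (Sym2 (Fin n))}

/-- What can happen in one round, unless Maker interferes a second time with the queue. -/
lemma Playing.round (hp : Playing b h) (hP : PathBound (makerGraph h) 10) (hbn : b ≤ n)
    {e : Sym2 (Fin n)} (he : e ∈ free (completeBoard n) h)
    (hh : ¬ ((stateAfter b h).hit ∧ IsHit (makerGraph h) (stateAfter b h) e))
    {h' : History (Sym2 (Fin n))} (hh' : h' = (e, (closingStrategy n b).move h e) :: h) :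
    PathBound (makerGraph h') 10 ∧ (free (completeBoard n) h' = ∅ ∨ Playing b h' ∧
      (stateAfter b h').opened ⊆ (stateAfter b h).opened ∧
      (((stateAfter b h).hit → (stateAfter b h').hit) ∧
        ((stateAfter b h').hit → (stateAfter b h).hit ∨ IsHit (makerGraph h) (stateAfter b h) e) ∧
        touching (free (completeBoard n) h') (stateAfter b h').queue + b ≤
          touching (free (completeBoard n) h) (stateAfter b h).queue +
            (stateAfter b h).cost e * (stateAfter b h).opened.card ∨
       ¬ (stateAfter b h').hit ∧
        touching (free (completeBoard n) h') (stateAfter b h').queue ≤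
          (stateAfter b h).opened.card)) := by
  set X := free (completeBoard n) h with hX
  set s := stateAfter b h with hs
  set s₁ := makerStep (makerGraph h) s e with hs1
  set S := (closingStrategy n b).move h e with hS
  have hSr : S = (s₁.response (X.erase e) b).1 := rfl
  have hst : stateAfter b h' = (s₁.response (X.erase e) b).2 := by rw [hh']; rfl
  have hfree : free (completeBoard n) h' = X.erase e \ S := by rw [hh', free_cons]
  have hlen : h'.length = h.length + 1 := by rw [hh', List.length_cons]
  have hmk : (makerSet h').card ≤ h.length + 1 := by
    rw [hh']
    exact (Finset.card_insert_le _ _).trans (Nat.add_le_add_right hp.card_maker 1)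
  clear_value S
  induction e with
  | _ u v =>
  have huv := (hp.sound.not_adj u v he).1
  have hadd : IsAddEdge (makerGraph h) (makerGraph h') u v := by
    rw [hh']; exact isAddEdge_makerGraph huv S h
  refine ⟨hp.sound.pathBound hadd he hP hh, ?_⟩
  have hs1' : Sound (makerGraph h') (X.erase s(u, v)) s₁ := hp.sound.after_maker hadd he
  have hW1 : touching (X.erase s(u, v)) s₁.queue ≤
      touching X s.queue + s.cost s(u, v) * s.opened.card := hp.sound.touching_makerStep_le he
  have ho1 : s₁.opened = s.opened := opened_makerStep _ _ _
  by_cases hb : b < (X.erase s(u, v)).card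
  · obtain ⟨w, hr, hadv⟩ := exists_response_eq s₁ hb
    rw [← hSr] at hr
    rw [← hst] at hadv
    have hw := hs1'.mem_opened_of_isResponse hb hr
    have hcard : (X.erase s(u, v) \ S).card + (b + 1) = X.card := by
      have h1 := Finset.card_sdiff_of_subset hr.1
      have h2 : S.card = b := hr.2.1
      have h3 := Finset.card_erase_of_mem he
      simp only at h1
      omega
    have hsound : Sound (makerGraph h') (free (completeBoard n) h') (stateAfter b h') := by
      rw [hfree, hadv]
      exact hs1'.after_breaker hb hr
    have hcf : (free (completeBoard n) h').card + h'.length * (b + 1) = n.choose 2 := by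
      rw [← hp.card_free, ← hX, hfree, hlen, ← hcard]
      ring
    have hsub : (stateAfter b h').opened ⊆ s.opened := by
      rw [← ho1, hadv]; exact opened_advance_subset hw
    right
    refine ⟨⟨hsound, hcf, ?_, hlen ▸ hmk⟩, hsub, ?_⟩
    · rcases hs1'.card_fresh_advance hw with h1 | h1
      · rw [hadv, h1, hlen]
        have h2 := card_fresh_makerStep (makerGraph h) s s(u, v)
        have h3 := hp.card_fresh
        rw [← hs] at h3
        rw [← hs1] at h2
        omega
      · rw [← hadv] at h1
        exact fresh_bound_of_choose_le hbn hcf (hsound.card_le.trans (Nat.choose_le_choose 2 h1))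
    · by_cases hwq : w ∈ s₁.queue
      · left
        refine ⟨fun hhit => ?_, fun hhit => ?_, ?_⟩
        · rw [hadv]
          exact ⟨hit_makerStep_of_hit _ _ hhit, hwq⟩
        · rw [hadv] at hhit
          exact hit_makerStep hhit.1
        · rw [hfree, hadv]
          exact (hs1'.touching_advance_add_le hr hwq).trans hW1
      · right
        constructor
        · rw [hadv]
          exact fun hhit => hwq hhit.2
        · have h1 := hsound.touching_singleton_le w
          have h2 : (stateAfter b h').queue = {w} := by rw [hadv, hs1'.queue_advance hwq]
          rw [h2]
          exact h1.trans (Finset.card_le_card hsub)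
  · left
    rw [hfree, hSr]
    unfold response
    rw [dif_neg hb]
    simp

end Strategy

end MakerBreaker

namespace MakerBreaker

/-! ### The drift of the number of unclaimed edges at the queue -/

/-- The left side is the total cost for an empty queue, in units of `n²`: it equals `x²/2 - g²/2 +
3(x-g)²/2`. -/
lemma drift_polynomial {x g : ℝ} (hx1 : x ≤ 1) (hg0 : 0 ≤ g) (hgx : g ≤ x)
    (hg : x ^ 2 - 0.011 ≤ g) : (2 * x - g) * (x - g) ≤ 0.44 * x := by
  rcases le_total x 0.2 with h | h
  · nlinarith
  · have h0 : 0 ≤ x ^ 2 - 0.011 := by nlinarith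
    have h1 : (2 * x - g) * (x - g) ≤
        (2 * x - (x ^ 2 - 0.011)) * (x - (x ^ 2 - 0.011)) := by
      apply mul_le_mul <;> nlinarith
    refine h1.trans ?_
    -- For `g = x²` this is `x(2-x)(1-x) ≤ 0.44`, whose left side has maximum `2/(3√3) ≈ 0.385` near
    -- `x = 0.42`, where the squares are centred.
    nlinarith [mul_nonneg (sub_nonneg.2 h) (sub_nonneg.2 hx1),
      mul_nonneg (mul_nonneg (sub_nonneg.2 h) (sub_nonneg.2 hx1)) (sq_nonneg (x - 0.42)),
      mul_nonneg (sub_nonneg.2 h) (sq_nonneg (x - 0.42)),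
      mul_nonneg (sub_nonneg.2 hx1) (sq_nonneg (x - 0.42)), sq_nonneg (x - 0.42),
      sq_nonneg (x ^ 2 - 0.42 * x), sq_nonneg (x ^ 2 - 0.1764)]

/-- The inequality behind the drift, in the scale where the number of vertices is one. -/
lemma scaled_drift {x e g w τ β k : ℝ} (hk0 : 0 < k) (hk : k ≤ 1e-7) (hx0 : 0 ≤ x) (hx1 : x ≤ 1)
    (hg0 : 0 ≤ g) (hgx : g ≤ x) (hτ0 : 0 ≤ τ) (hτ1 : τ ≤ 1) (hβ : 0.99 ≤ β + k)
    (hw : w ≤ 1e-6) (he : 0.001 ≤ e) (h1 : (x - k) * (x - 2 * k) / 2 ≤ e + τ * k)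
    (h2 : e ≤ x ^ 2 / 2) (h3 : e + τ * (β + k) = 1 / 2 - k / 2) (h4 : 1 - 2 * τ - k ≤ g) :
    x * (e - g * (g - k) / 2 + 3 * ((x - g) ^ 2 / 2 + w)) ≤ 0.9 * e := by
  have hτk : τ * k ≤ k := by nlinarith
  have hxk : x * k ≤ k := by nlinarith
  have he2 : x ^ 2 / 2 - 3 * k ≤ e := by nlinarith
  have hτ : 0.99 * τ ≤ 1 / 2 - x ^ 2 / 2 + 3 * k := by nlinarith
  -- Since `2τ` is at most about `(1 - x²)/0.99`, `1 - 2τ` is at least about `x² - 0.0102`; the rest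
  -- of 0.011 absorbs the terms in `k`.
  have hg : x ^ 2 - 0.011 ≤ g := by nlinarith
  have hp := drift_polynomial hx1 hg0 hgx hg
  have h5 : x * (e - g ^ 2 / 2 + 3 * (x - g) ^ 2 / 2) ≤ x * (0.44 * x) := by
    apply mul_le_mul_of_nonneg_left _ hx0
    nlinarith
  have h6 : x * g * k ≤ k := by
    have : x * g ≤ 1 := by nlinarith
    nlinarith
  have h7 : x * w ≤ 1e-6 := by nlinarith
  -- The right side is about `0.45 x²`; the margin `0.01 x²` beats all error terms because `x² ≥ 2e
  -- ≥ 0.002`.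
  nlinarith

lemma unscaled_drift {N E W o f a t b S : ℝ} (hN : 1e7 ≤ N) (ho1 : o ≤ N)
    (hf0 : 0 ≤ f) (ha1 : a ≤ o - f) (ha0 : 0 ≤ a) (ht0 : 0 ≤ t) (htN : t ≤ N)
    (hb : 0.99 * N - 1 ≤ b) (hW : W ≤ 1e-6 * N ^ 2) (hE : 0.001 * N ^ 2 ≤ E)
    (h1 : (o - 1) * (o - 2) / 2 ≤ E + t) (h2 : E ≤ o * (o - 1) / 2)
    (h3 : E + t * (b + 1) = N * (N - 1) / 2) (h4 : N ≤ f + 1 + 2 * t)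
    (hS : S + f * (f - 1) / 2 ≤ E + 3 * (a * (a - 1) / 2 + W)) :
    o * S ≤ 0.9 * N * E := by
  have hN0 : 0 < N := by linarith
  have ho0 : 0 ≤ o := by linarith
  have hkN : 1 / N * N = 1 := by field_simp
  set k := 1 / N with hk
  have hk0 : 0 < k := by positivity
  have hk7 : k ≤ 1e-7 := by
    rw [hk, div_le_iff₀ hN0]; linarith
  obtain ⟨x, rfl⟩ : ∃ x, o = x * N := ⟨o / N, by field_simp⟩
  obtain ⟨g, rfl⟩ : ∃ x, f = x * N := ⟨f / N, by field_simp⟩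
  obtain ⟨τ, rfl⟩ : ∃ x, t = x * N := ⟨t / N, by field_simp⟩
  obtain ⟨β, rfl⟩ : ∃ x, b = x * N := ⟨b / N, by field_simp⟩
  obtain ⟨e, rfl⟩ : ∃ x, E = x * N ^ 2 := ⟨E / N ^ 2, by field_simp⟩
  obtain ⟨w, rfl⟩ : ∃ x, W = x * N ^ 2 := ⟨W / N ^ 2, by field_simp⟩
  have hN2 : 0 < N ^ 2 := by positivity
  have cancel : ∀ p q : ℝ, p * N ≤ q * N → p ≤ q := fun p q h => le_of_mul_le_mul_right h hN0
  have cancel2 : ∀ p q : ℝ, p * N ^ 2 ≤ q * N ^ 2 → p ≤ q :=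
    fun p q h => le_of_mul_le_mul_right h hN2
  have hx0 : 0 ≤ x := cancel _ _ (by linarith)
  have key := scaled_drift (x := x) (e := e) (g := g) (w := w) (τ := τ) (β := β) hk0 hk7 hx0
    (cancel _ _ (by linarith)) (cancel _ _ (by linarith)) (cancel _ _ (by linarith))
    (cancel _ _ (by linarith)) (cancel _ _ (by linarith)) (cancel _ _ (by nlinarith))
    (cancel2 _ _ (by linarith)) (cancel2 _ _ (by linarith)) ?_ ?_ ?_ ?_
  · have hS' : S ≤ (e - g * (g - k) / 2 + 3 * ((x - g) ^ 2 / 2 + w)) * N ^ 2 := by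
      have e1 : g * (g - k) * N ^ 2 = g * N * (g * N - 1) := by
        calc g * (g - k) * N ^ 2 = g * N * (g * N - k * N) := by ring
          _ = _ := by rw [hkN]
      have e2 : a * (a - 1) ≤ (x - g) ^ 2 * N ^ 2 := by
        have : a ≤ (x - g) * N := by linarith
        have h5 : a * a ≤ ((x - g) * N) * ((x - g) * N) := mul_self_le_mul_self ha0 this
        nlinarith
      nlinarith
    calc x * N * S ≤ x * N * ((e - g * (g - k) / 2 + 3 * ((x - g) ^ 2 / 2 + w)) * N ^ 2) :=
          mul_le_mul_of_nonneg_left hS' ho0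
      _ = (x * (e - g * (g - k) / 2 + 3 * ((x - g) ^ 2 / 2 + w))) * N ^ 3 := by ring
      _ ≤ (0.9 * e) * N ^ 3 := mul_le_mul_of_nonneg_right key (by positivity)
      _ = _ := by ring
  · apply cancel2
    have e1 : (x - k) * (x - 2 * k) / 2 * N ^ 2 = (x * N - k * N) * (x * N - 2 * (k * N)) / 2 := by
      ring
    have e2 : (e + τ * k) * N ^ 2 = e * N ^ 2 + τ * N * (k * N) := by ring
    rw [e1, e2, hkN]
    linarith
  · apply cancel2
    nlinarith
  · have h6 : (e + τ * (β + k)) * N ^ 2 = (1 / 2 - k / 2) * N ^ 2 := by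
      have e1 : (e + τ * (β + k)) * N ^ 2 = e * N ^ 2 + τ * N * (β * N + k * N) := by ring
      have e2 : (1 / 2 - k / 2) * N ^ 2 = N * (N - k * N) / 2 := by ring
      rw [e1, e2, hkN]
      linarith
    exact mul_right_cancel₀ hN2.ne' h6
  · apply cancel
    have e1 : (1 - 2 * τ - k) * N = N - 2 * (τ * N) - k * N := by ring
    rw [e1, hkN]
    linarith

/-- Exponential moments of a bounded variable with negative mean. -/
lemma sum_exp_le {ι : Type*} {X : Finset ι} {Δ : ι → ℝ} {μ : ℝ} (hμ0 : 0.0005 ≤ μ)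
    (hμ1 : μ ≤ 0.001) (hΔ : ∀ e ∈ X, |Δ e| ≤ 5) (hsum : ∑ e ∈ X, Δ e ≤ -0.05 * X.card) :
    ∑ e ∈ X, Real.exp (μ * Δ e) ≤ (1 - 1e-5) * X.card := by
  have hpt : ∀ e ∈ X, Real.exp (μ * Δ e) ≤ 1 + μ * Δ e + 25 * μ ^ 2 := by
    intro e he
    have h1 := abs_le.1 (hΔ e he)
    have h2 : |μ * Δ e| ≤ 1 := by
      rw [abs_le]; constructor <;> nlinarith
    have h3 := (abs_le.1 (Real.abs_exp_sub_one_sub_id_le h2)).2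
    have h4 : (μ * Δ e) ^ 2 ≤ 25 * μ ^ 2 := by
      rw [mul_pow]
      have : Δ e ^ 2 ≤ 25 := by nlinarith
      nlinarith [sq_nonneg μ]
    linarith
  refine (Finset.sum_le_sum hpt).trans ?_
  rw [Finset.sum_add_distrib, Finset.sum_add_distrib, ← Finset.mul_sum, Finset.sum_const,
    Finset.sum_const, nsmul_eq_mul, nsmul_eq_mul]
  have hc : (0 : ℝ) ≤ X.card := Nat.cast_nonneg _
  have h1 : μ * ∑ e ∈ X, Δ e ≤ μ * (-0.05 * X.card) := mul_le_mul_of_nonneg_left hsum (by linarith)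
  have h2 : 25 * μ ^ 2 - 0.05 * μ ≤ -1e-5 := by nlinarith
  nlinarith

end MakerBreaker

namespace MakerBreaker

open GameState

/-! ### The potential -/

section Potential

variable {n : ℕ}

/-- The part of the potential that depends on the number of rounds. -/
noncomputable def roundPotential (h : History (Sym2 (Fin n))) : ℝ :=
  1.024e25 * max 0 ((n : ℝ) - h.length) / (n : ℝ) ^ 2

lemma roundPotential_nonneg {h : History (Sym2 (Fin n))} : 0 ≤ roundPotential h := by
  unfold roundPotential; positivity

/-- The number of unclaimed edges. -/
def freeCount (h : History (Sym2 (Fin n))) : ℝ := (free (completeBoard n) h).card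

variable [NeZero n]

/-- The number of unclaimed edges at the queue. -/
noncomputable def load (b : ℕ) (h : History (Sym2 (Fin n))) : ℝ :=
  touching (free (completeBoard n) h) (stateAfter b h).queue

/-- The number of vertices that are not closed. -/
noncomputable def openCount (b : ℕ) (h : History (Sym2 (Fin n))) : ℝ :=
  (stateAfter b h).opened.card

/-- The load, with a penalty towards the end of the game. -/
noncomputable def excess (b : ℕ) (h : History (Sym2 (Fin n))) : ℝ :=
  load b h + max 0 (0.001 * (n : ℝ) ^ 2 - freeCount h) / 2

/-- The exponential weight of the excess. -/
noncomputable def weight (b : ℕ) (h : History (Sym2 (Fin n))) : ℝ :=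
  Real.exp (0.0005 * (excess b h / n))

/-- From now on, Breaker can close all vertices of the queue in each round. -/
def Calm (b : ℕ) (h : History (Sym2 (Fin n))) : Prop :=
  free (completeBoard n) h = ∅ ∨ freeCount h ≤ 0.001 * (n : ℝ) ^ 2 ∧ ¬ (stateAfter b h).hit ∧
    load b h ≤ n / 2

open Classical in
/-- The part of the potential that depends on the queue. -/
noncomputable def queuePotential (b : ℕ) (h : History (Sym2 (Fin n))) : ℝ :=
  if (stateAfter b h).hit then 1.6e12 * weight b h / n else 5.12e24 * weight b h ^ 2 / (n : ℝ) ^ 2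

open Classical in
/-- An upper bound for the probability that Maker wins after the history `h`. -/
noncomputable def potential (b : ℕ) (h : History (Sym2 (Fin n))) : ℝ :=
  if Safe b h then if Calm b h then 0 else min 1 (roundPotential h + queuePotential b h) else 1

variable {b : ℕ} {h h' : History (Sym2 (Fin n))}

lemma n_pos : (0 : ℝ) < n := by
  exact_mod_cast Nat.pos_of_ne_zero (NeZero.ne n)

lemma potential_le_one : potential b h ≤ 1 := by
  unfold potential
  split_ifs
  · exact zero_le_one
  · exact min_le_left _ _
  · exact le_rfl

lemma weight_pos : 0 < weight b h := Real.exp_pos _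

lemma queuePotential_nonneg : 0 ≤ queuePotential b h := by
  have := weight_pos (b := b) (h := h)
  unfold queuePotential
  split_ifs <;> positivity

lemma potential_nonneg : 0 ≤ potential b h := by
  unfold potential
  split_ifs
  · exact le_rfl
  · exact le_min zero_le_one (add_nonneg roundPotential_nonneg queuePotential_nonneg)
  · exact zero_le_one

lemma potential_eq_zero (hs : Safe b h) (hc : Calm b h) : potential b h = 0 := by
  unfold potential
  rw [if_pos hs, if_pos hc]

lemma potential_le (hs : Safe b h) : potential b h ≤ roundPotential h + queuePotential b h := by
  unfold potential
  rw [if_pos hs]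
  split_ifs
  · exact add_nonneg roundPotential_nonneg queuePotential_nonneg
  · exact min_le_right _ _

lemma load_nonneg : 0 ≤ load b h := Nat.cast_nonneg _

lemma load_le_excess : load b h ≤ excess b h := by
  unfold excess
  have : 0 ≤ max 0 (0.001 * (n : ℝ) ^ 2 - freeCount h) := le_max_left _ _
  linarith

lemma one_le_weight : 1 ≤ weight b h := by
  unfold weight
  rw [Real.one_le_exp_iff]
  have := load_nonneg (b := b) (h := h)
  have := load_le_excess (b := b) (h := h)
  have : 0 ≤ excess b h := by linarith
  positivity

lemma load_le_weight : n + 0.0005 * load b h ≤ n * weight b h := by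
  have hn := n_pos (n := n)
  have h1 := Real.add_one_le_exp (0.0005 * (excess b h / n))
  have h2 : n * (0.0005 * (excess b h / n) + 1) ≤ n * weight b h :=
    mul_le_mul_of_nonneg_left h1 hn.le
  have h3 : n * (0.0005 * (excess b h / n) + 1) = n + 0.0005 * excess b h := by
    field_simp; ring
  have := load_le_excess (b := b) (h := h)
  linarith

/-! ### Drift of the excess -/

/-- The bounds of a game that is not over yet. -/
lemma Playing.bounds (hp : Playing b h) :
    (openCount b h - 1) * (openCount b h - 2) / 2 ≤ freeCount h + h.length ∧
    freeCount h ≤ openCount b h * (openCount b h - 1) / 2 ∧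
    freeCount h + h.length * (b + 1) = n * (n - 1) / 2 ∧
    (n : ℝ) ≤ (stateAfter b h).fresh.card + 1 + 2 * h.length ∧
    ∑ e ∈ free (completeBoard n) h, ((stateAfter b h).cost e : ℝ) +
      (stateAfter b h).fresh.card * ((stateAfter b h).fresh.card - 1) / 2 ≤
      freeCount h + 3 * ((stateAfter b h).active.card * ((stateAfter b h).active.card - 1) / 2 +
        load b h) ∧
    ((stateAfter b h).active.card : ℝ) ≤ openCount b h - (stateAfter b h).fresh.card ∧
    openCount b h ≤ n ∧ 1 ≤ openCount b h := by
  have ho1 : 1 ≤ (stateAfter b h).opened.card :=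
    Finset.card_pos.2 ⟨_, GameState.mem_opened.2 (Or.inl hp.sound.head_mem)⟩
  refine ⟨?_, ?_, ?_, ?_, ?_, ?_, ?_, ?_⟩
  · have h1 := (hp.sound.choose_le (M := makerSet h) adj_mem_makerSet).trans
      (Nat.add_le_add_left hp.card_maker _)
    have h2 : (((stateAfter b h).opened.card - 1).choose 2 : ℝ) ≤
        ((free (completeBoard n) h).card : ℝ) + h.length := by exact_mod_cast h1
    rw [Nat.cast_choose_two, Nat.cast_sub ho1] at h2
    unfold openCount freeCount
    refine le_trans (le_of_eq ?_) h2
    push_cast; ring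
  · have h1 : ((free (completeBoard n) h).card : ℝ) ≤ ((stateAfter b h).opened.card.choose 2 : ℝ) :=
      by exact_mod_cast hp.sound.card_le
    rwa [Nat.cast_choose_two] at h1
  · have h1 : (((free (completeBoard n) h).card + h.length * (b + 1) : ℕ) : ℝ) =
        (n.choose 2 : ℝ) := by rw [hp.card_free]
    rw [Nat.cast_choose_two] at h1
    push_cast at h1
    exact h1
  · exact_mod_cast hp.card_fresh
  · have h1 : ((∑ e ∈ free (completeBoard n) h, (stateAfter b h).cost e +
        (stateAfter b h).fresh.card.choose 2 : ℕ) : ℝ) ≤ _ := Nat.cast_le.2 hp.sound.sum_cost_le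
    push_cast at h1
    rw [Nat.cast_choose_two, Nat.cast_choose_two] at h1
    exact h1
  · have h1 : (stateAfter b h).active.card + (stateAfter b h).fresh.card ≤
        (stateAfter b h).opened.card := by
      rw [← Finset.card_union_of_disjoint hp.sound.disjoint_active_fresh]
      apply Finset.card_le_card
      intro x hx
      rw [Finset.mem_union] at hx
      exact GameState.mem_opened.2 (Or.inr hx)
    have h2 : ((stateAfter b h).active.card : ℝ) + (stateAfter b h).fresh.card ≤
      (stateAfter b h).opened.card := by exact_mod_cast h1
    unfold openCount
    linarith
  · have h1 := (stateAfter b h).opened.card_le_univ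
    rw [Fintype.card_fin] at h1
    unfold openCount
    exact_mod_cast h1
  · unfold openCount
    exact_mod_cast ho1

lemma Playing.length_le (hp : Playing b h) (hn : (1e7 : ℝ) ≤ n) (hb : 0.99 * (n : ℝ) - 1 ≤ b) :
    (h.length : ℝ) + 1 ≤ n := by
  obtain ⟨-, -, h3, -⟩ := hp.bounds
  have h0 : 0 ≤ freeCount h := Nat.cast_nonneg _
  by_contra! hlt
  nlinarith

/-- The number of open vertices is at most about `√0.002 n ≈ 0.045 n`, as almost all pairs of them
are unclaimed. -/
lemma Playing.openCount_le (hp : Playing b h) (hn : (1e7 : ℝ) ≤ n)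
    (hb : 0.99 * (n : ℝ) - 1 ≤ b) (hE : freeCount h ≤ 0.001 * (n : ℝ) ^ 2 + n) :
    openCount b h ≤ 0.05 * n := by
  obtain ⟨h1, -⟩ := hp.bounds
  have := hp.length_le hn hb
  by_contra! hlt
  nlinarith

open Classical in
/-- An upper bound for the increase of the excess in a round in which Maker claims `e`, if the
queue does not become empty. -/
noncomputable def increment (b : ℕ) (h : History (Sym2 (Fin n))) (e : Sym2 (Fin n)) : ℝ :=
  ((stateAfter b h).cost e * openCount b h - b) / n +
    if freeCount h ≤ 0.001 * (n : ℝ) ^ 2 + n then ((b : ℝ) + 1) / (2 * n) else 0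

lemma Playing.abs_increment_le (hp : Playing b h) (hn : (1e7 : ℝ) ≤ n) (hbn : (b : ℝ) ≤ n)
    (e : Sym2 (Fin n)) : -1 ≤ increment b h e ∧ increment b h e ≤ 5 := by
  have hn0 := n_pos (n := n)
  obtain ⟨-, -, -, -, -, -, h7, h8⟩ := hp.bounds
  have hc : ((stateAfter b h).cost e : ℝ) ≤ 4 := by exact_mod_cast cost_le_four _ _
  have hc0 : (0 : ℝ) ≤ (stateAfter b h).cost e := Nat.cast_nonneg _
  have hb0 : (0 : ℝ) ≤ b := Nat.cast_nonneg _
  have h1 : -1 ≤ ((stateAfter b h).cost e * openCount b h - b) / (n : ℝ) := by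
    rw [le_div_iff₀ hn0]; nlinarith
  have h2 : ((stateAfter b h).cost e * openCount b h - b) / (n : ℝ) ≤ 4 := by
    rw [div_le_iff₀ hn0]; nlinarith
  have h3 : ((b : ℝ) + 1) / (2 * n) ≤ 1 := by
    rw [div_le_iff₀ (by positivity)]; linarith
  have h4 : 0 ≤ ((b : ℝ) + 1) / (2 * n) := by positivity
  unfold increment
  split_ifs <;> constructor <;> linarith

/-- In the main phase the mean is about `0.9 - 0.99`. Near the end at most 4 · 0.05 = 0.2 is added
and the penalty costs about 0.5, still well below 0.99. -/
lemma Playing.sum_increment_le (hp : Playing b h) (hn : (1e7 : ℝ) ≤ n)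
    (hb : 0.99 * (n : ℝ) - 1 ≤ b) (hex : excess b h ≤ 1e-6 * (n : ℝ) ^ 2) :
    ∑ e ∈ free (completeBoard n) h, increment b h e ≤
      -0.05 * (free (completeBoard n) h).card := by
  have hn0 := n_pos (n := n)
  obtain ⟨h1, h2, h3, h4, h5, h6, h7, h8⟩ := hp.bounds
  have hlen := hp.length_le hn hb
  by_cases hE : freeCount h ≤ 0.001 * (n : ℝ) ^ 2 + n
  · have ho := hp.openCount_le hn hb hE
    have hpt : ∀ e ∈ free (completeBoard n) h, increment b h e ≤ -0.05 := by
      intro e _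
      have hc : ((stateAfter b h).cost e : ℝ) ≤ 4 := by exact_mod_cast cost_le_four _ _
      unfold increment
      rw [if_pos hE, div_add_div _ _ hn0.ne' (by positivity), div_le_iff₀ (by positivity)]
      have h9 : (stateAfter b h).cost e * openCount b h ≤ 0.2 * (n : ℝ) := by nlinarith
      nlinarith
    have := Finset.sum_le_card_nsmul _ _ _ hpt
    rw [nsmul_eq_mul] at this
    linarith
  · have hdr := unscaled_drift (S := ∑ e ∈ free (completeBoard n) h, ((stateAfter b h).cost e : ℝ))
      hn h7 (Nat.cast_nonneg _) h6 (Nat.cast_nonneg _)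
      (Nat.cast_nonneg _) (by linarith) hb (load_le_excess.trans hex) (by linarith) h1 h2 h3 h4 h5
    unfold increment
    simp only [if_neg hE, add_zero]
    rw [← Finset.sum_div, Finset.sum_sub_distrib, ← Finset.sum_mul, Finset.sum_const,
      nsmul_eq_mul, div_le_iff₀ hn0]
    have hE0 : (0 : ℝ) ≤ (free (completeBoard n) h).card := Nat.cast_nonneg _
    unfold freeCount at hdr
    nlinarith

lemma Playing.sum_exp_increment_le (hp : Playing b h) (hn : (1e7 : ℝ) ≤ n) (hbn : (b : ℝ) ≤ n)
    (hb : 0.99 * (n : ℝ) - 1 ≤ b) (hex : excess b h ≤ 1e-6 * (n : ℝ) ^ 2) {μ : ℝ}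
    (hμ0 : 0.0005 ≤ μ) (hμ1 : μ ≤ 0.001) :
    ∑ e ∈ free (completeBoard n) h, Real.exp (μ * increment b h e) ≤ (1 - 1e-5) * freeCount h := by
  refine sum_exp_le hμ0 hμ1 (fun e _ => ?_) (hp.sum_increment_le hn hb hex)
  have := hp.abs_increment_le hn hbn e
  rw [abs_le]
  constructor <;> linarith

lemma freeCount_ge_of_excess (hex : excess b h ≤ 1e-6 * (n : ℝ) ^ 2) :
    0.0005 * (n : ℝ) ^ 2 ≤ freeCount h := by
  unfold excess at hex
  have h1 := load_nonneg (b := b) (h := h)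
  have h2 := le_max_right 0 (0.001 * (n : ℝ) ^ 2 - freeCount h)
  have : 0 ≤ (n : ℝ) ^ 2 := by positivity
  linarith

open Classical in
-- The factor 8000 is 4/0.0005: the weight dominates its linear part `1 + 0.0005 · load/n`.
lemma Playing.card_hit_le (hp : Playing b h) (hn : (1e7 : ℝ) ≤ n)
    (hex : excess b h ≤ 1e-6 * (n : ℝ) ^ 2) :
    (((free (completeBoard n) h).filter fun e =>
      IsHit (makerGraph h) (stateAfter b h) e).card : ℝ) ≤ 8000 * (n * weight b h) := by
  obtain ⟨-, h2, -, -, -, -, h7, h8⟩ := hp.bounds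
  have hE := freeCount_ge_of_excess hex
  have ho : 9 ≤ openCount b h := by
    by_contra! hlt
    nlinarith
  have h9 : (((free (completeBoard n) h).filter fun e =>
      IsHit (makerGraph h) (stateAfter b h) e).card : ℝ) ≤ 4 * load b h + openCount b h := by
    have := hp.sound.card_hit_le (by unfold openCount at ho; exact_mod_cast ho)
    unfold load openCount
    exact_mod_cast this
  have h10 := load_le_weight (b := b) (h := h)
  have := n_pos (n := n)
  linarith

end Potential

end MakerBreaker

namespace MakerBreaker

open GameState

/-! ### The supermartingale inequality -/

section Step

lemma exp_le_two {x : ℝ} (hx : x ≤ 1 / 2) : Real.exp x ≤ 2 := by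
  refine (Real.exp_le_exp.2 hx).trans ?_
  have := (abs_le.1 (Real.abs_exp_sub_one_sub_id_le (x := 1 / 2) (by norm_num [abs_le]))).2
  linarith

lemma roundPotential_cons {n : ℕ} {h : History (Sym2 (Fin n))}
    (r : Sym2 (Fin n) × Finset (Sym2 (Fin n)))
    (hlen : (h.length : ℝ) + 1 ≤ n) :
    roundPotential (r :: h) = roundPotential h - 1.024e25 / (n : ℝ) ^ 2 := by
  unfold roundPotential
  rw [List.length_cons, max_eq_right, max_eq_right]
  · push_cast; ring
  · linarith
  · push_cast; linarith

variable {n : ℕ} [NeZero n] {b : ℕ} {h h' : History (Sym2 (Fin n))}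

/-- After Maker's edge the load is at most about `n/2 + 4 · 0.05n < b`, so unless the game ends
Breaker exhausts the queue within the same round and calm persists. -/
lemma Safe.calm_step (hs : Safe b h) (hc : Calm b h) (hn : (1e7 : ℝ) ≤ n) (hbn : b ≤ n)
    (hb : 0.99 * (n : ℝ) - 1 ≤ b) {e : Sym2 (Fin n)} (he : e ∈ free (completeBoard n) h) :
    potential b ((e, (closingStrategy n b).move h e) :: h) = 0 := by
  have hne : free (completeBoard n) h ≠ ∅ := Finset.ne_empty_of_mem he
  have hp := hs.2.resolve_left hne
  obtain ⟨hE, hhit, hW⟩ := hc.resolve_left hne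
  have ho := hp.openCount_le hn hb (by linarith)
  obtain ⟨hP, hrest⟩ := hp.round hs.1 hbn he (fun hcon => hhit hcon.1) rfl
  set h' := (e, (closingStrategy n b).move h e) :: h with hh'
  rcases hrest with hover | ⟨hp', -, hcase⟩
  · exact potential_eq_zero ⟨hP, Or.inl hover⟩ (Or.inl hover)
  · apply potential_eq_zero ⟨hP, Or.inr hp'⟩
    right
    rcases hcase with ⟨-, -, hcon⟩ | ⟨hhit', hW'⟩
    · exfalso
      have hc4 : (stateAfter b h).cost e * (stateAfter b h).opened.card ≤
        4 * (stateAfter b h).opened.card := Nat.mul_le_mul_right _ (cost_le_four _ _)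
      have h1 : (b : ℝ) ≤ load b h + 4 * openCount b h := by
        unfold load openCount
        exact_mod_cast (by omega)
      linarith
    · refine ⟨?_, hhit', ?_⟩
      · refine le_trans ?_ hE
        unfold freeCount
        rw [hh', free_cons]
        exact_mod_cast Finset.card_le_card (Finset.sdiff_subset.trans (Finset.erase_subset _ _))
      · have h1 : load b h' ≤ openCount b h := by
          unfold load openCount
          exact_mod_cast hW'
        linarith

lemma Playing.weight_le_of_load_le (hp : Playing b h) (hp' : Playing b h') (hbn : (b : ℝ) + 1 ≤ n)
    (hlen : h'.length = h.length + 1) {e : Sym2 (Fin n)}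
    (hW : load b h' + b ≤ load b h + (stateAfter b h).cost e * openCount b h) :
    weight b h' ≤ weight b h * Real.exp (0.0005 * increment b h e) := by
  have hn0 := n_pos (n := n)
  unfold weight
  rw [← Real.exp_add, Real.exp_le_exp, ← mul_add]
  apply mul_le_mul_of_nonneg_left _ (by norm_num)
  obtain ⟨-, -, h3, -⟩ := hp.bounds
  obtain ⟨-, -, h3', -⟩ := hp'.bounds
  rw [hlen] at h3'
  push_cast at h3'
  have hE : freeCount h = freeCount h' + (b + 1) := by linarith
  -- One round removes `b + 1 ≤ n` edges, so the penalty cannot start while more than `0.001n² + n`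
  -- are unclaimed.
  have hmax : max 0 (0.001 * (n : ℝ) ^ 2 - freeCount h') ≤
      max 0 (0.001 * (n : ℝ) ^ 2 - freeCount h) +
        if freeCount h ≤ 0.001 * (n : ℝ) ^ 2 + n then (b : ℝ) + 1 else 0 := by
    have hb0 : (0 : ℝ) ≤ b := Nat.cast_nonneg _
    have h5 := le_max_left 0 (0.001 * (n : ℝ) ^ 2 - freeCount h)
    have h6 := le_max_right 0 (0.001 * (n : ℝ) ^ 2 - freeCount h)
    split_ifs with h4
    · apply max_le <;> linarith
    · have h7 : freeCount h' ≥ 0.001 * (n : ℝ) ^ 2 := by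
        linarith [not_le.1 h4]
      apply max_le <;> linarith
  rw [div_add' _ _ _ hn0.ne', div_le_div_iff_of_pos_right hn0]
  have hinc : increment b h e * n = (stateAfter b h).cost e * openCount b h - b +
      (if freeCount h ≤ 0.001 * (n : ℝ) ^ 2 + n then (b : ℝ) + 1 else 0) / 2 := by
    unfold increment
    split_ifs
    · field_simp
    · field_simp; ring
  rw [hinc]
  unfold excess
  linarith

open Classical in
/-- An upper bound for the queue potential after a round in which Maker claims `e`. -/
noncomputable def successorBound (b : ℕ) (h : History (Sym2 (Fin n))) (e : Sym2 (Fin n)) : ℝ :=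
  if (stateAfter b h).hit then 1.6e12 * (weight b h * Real.exp (0.0005 * increment b h e)) / n
  else 5.12e24 * (weight b h ^ 2 * Real.exp (0.001 * increment b h e)) / (n : ℝ) ^ 2 +
    1.024e25 / (n : ℝ) ^ 2 +
    if IsHit (makerGraph h) (stateAfter b h) e then 1.6e12 * (weight b h * 2) / n else 0

/-- If the queue survives, the weight changes by the exponential of the increment. If it is
replaced, the new queue potential is at most `1.024e25/n²`, unless calm sets in; `successorBound`
has room for it. -/
lemma Playing.potential_succ_le (hp : Playing b h) (hP : PathBound (makerGraph h) 10)
    (hn : (1e14 : ℝ) ≤ n) (hbn : b + 1 ≤ n) (hb : 0.99 * (n : ℝ) - 1 ≤ b) {e : Sym2 (Fin n)}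
    (he : e ∈ free (completeBoard n) h)
    (hh : ¬ ((stateAfter b h).hit ∧ IsHit (makerGraph h) (stateAfter b h) e)) :
    potential b ((e, (closingStrategy n b).move h e) :: h) ≤
      roundPotential h - 1.024e25 / (n : ℝ) ^ 2 + successorBound b h e := by
  classical
  have hn0 := n_pos (n := n)
  have hn7 : (1e7 : ℝ) ≤ n := by linarith
  have hbn1 : (b : ℝ) + 1 ≤ n := by exact_mod_cast hbn
  have hbn' : (b : ℝ) ≤ n := by linarith
  have hw0 := weight_pos (b := b) (h := h)
  have hw1 := one_le_weight (b := b) (h := h)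
  have hinc := hp.abs_increment_le hn7 hbn' e
  rw [← roundPotential_cons (e, (closingStrategy n b).move h e) (hp.length_le hn7 hb)]
  obtain ⟨hP', hrest⟩ := hp.round hP (by omega) he hh rfl
  set h' := (e, (closingStrategy n b).move h e) :: h with hh'
  have hr0 : 0 ≤ roundPotential h' := roundPotential_nonneg
  have hs0 : 0 ≤ successorBound b h e := by
    unfold successorBound; split_ifs <;> positivity
  rcases hrest with hover | ⟨hp', -, hcase⟩
  · rw [potential_eq_zero ⟨hP', Or.inl hover⟩ (Or.inl hover)]
    linarith
  have hsafe : Safe b h' := ⟨hP', Or.inr hp'⟩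
  rcases hcase with ⟨hhit1, hhit2, hW⟩ | ⟨hhit, hW⟩
  · refine (potential_le hsafe).trans (add_le_add_right ?_ _)
    have hwt : weight b h' ≤ weight b h * Real.exp (0.0005 * increment b h e) := by
      apply hp.weight_le_of_load_le hp' hbn1 (by rw [hh', List.length_cons])
      unfold load openCount
      exact_mod_cast hW
    have hw' := weight_pos (b := b) (h := h')
    unfold queuePotential successorBound
    by_cases hh1 : (stateAfter b h).hit
    · rw [if_pos (hhit1 hh1), if_pos hh1]
      gcongr
    · rw [if_neg hh1]
      by_cases hh2 : (stateAfter b h').hit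
      · rw [if_pos hh2, if_pos ((hhit2 hh2).resolve_left hh1)]
        have h1 : weight b h' ≤ weight b h * 2 :=
          hwt.trans (mul_le_mul_of_nonneg_left (exp_le_two (by linarith)) hw0.le)
        have h2 : 1.6e12 * weight b h' / (n : ℝ) ≤ 1.6e12 * (weight b h * 2) / n := by gcongr
        have h3 : 0 ≤ 5.12e24 * (weight b h ^ 2 * Real.exp (0.001 * increment b h e)) /
          (n : ℝ) ^ 2 + 1.024e25 / (n : ℝ) ^ 2 := by positivity
        linarith
      · rw [if_neg hh2]
        have h1 : weight b h' ^ 2 ≤ weight b h ^ 2 * Real.exp (0.001 * increment b h e) := by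
          have h2 : (weight b h * Real.exp (0.0005 * increment b h e)) ^ 2 =
              weight b h ^ 2 * Real.exp (0.001 * increment b h e) := by
            rw [mul_pow, ← Real.exp_nat_mul]
            congr 2
            push_cast; ring
          rw [← h2]
          exact pow_le_pow_left₀ hw'.le hwt 2
        have h2 : 5.12e24 * weight b h' ^ 2 / (n : ℝ) ^ 2 ≤
          5.12e24 * (weight b h ^ 2 * Real.exp (0.001 * increment b h e)) / (n : ℝ) ^ 2 := by
          gcongr
        have h3 : (0 : ℝ) ≤ 1.024e25 / (n : ℝ) ^ 2 := by positivity
        have h4 : 0 ≤ if IsHit (makerGraph h) (stateAfter b h) e then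
            1.6e12 * (weight b h * 2) / (n : ℝ) else 0 := by split_ifs <;> positivity
        linarith
  · have hW' : load b h' ≤ openCount b h := by
      unfold load openCount
      exact_mod_cast hW
    by_cases hE : freeCount h' ≤ 0.001 * (n : ℝ) ^ 2
    · have hc : Calm b h' := by
        refine Or.inr ⟨hE, hhit, ?_⟩
        have hE' : freeCount h ≤ 0.001 * (n : ℝ) ^ 2 + n + 1 := by
          obtain ⟨-, -, h3, -⟩ := hp.bounds
          obtain ⟨-, -, h3', -⟩ := hp'.bounds
          rw [hh', List.length_cons] at h3'
          push_cast at h3'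
          rw [← hh'] at h3'
          linarith
        obtain ⟨h1, -⟩ := hp.bounds
        have := hp.length_le hn7 hb
        refine hW'.trans ?_
        by_contra! hlt
        nlinarith
      rw [potential_eq_zero hsafe hc]
      linarith
    · refine (potential_le hsafe).trans (add_le_add_right ?_ _)
      -- A queue with one vertex has load at most `n`, and the penalty has not started.
      have hwt : weight b h' ^ 2 ≤ 2 := by
        have hex : excess b h' / n ≤ 1 := by
          rw [div_le_one hn0]
          unfold excess
          rw [max_eq_left (by linarith)]
          obtain ⟨-, -, -, -, -, -, h7, -⟩ := hp.bounds
          linarith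
        unfold weight
        rw [← Real.exp_nat_mul]
        apply exp_le_two
        push_cast
        linarith
      have hq : queuePotential b h' ≤ 1.024e25 / (n : ℝ) ^ 2 := by
        unfold queuePotential
        rw [if_neg hhit]
        gcongr
        linarith
      refine hq.trans ?_
      unfold successorBound
      split_ifs
      -- After a hit the old term is at least of order `1/n`, which exceeds the `1/n²` term of a new
      -- queue as `n ≥ 1e14`.
      · rw [div_le_div_iff₀ (by positivity) hn0]
        have h1 := Real.add_one_le_exp (0.0005 * increment b h e)
        have h2 : 0.9 ≤ weight b h * Real.exp (0.0005 * increment b h e) := by nlinarith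
        have h3 : 1.6e12 * 0.9 * (n : ℝ) ^ 2 ≤
            1.6e12 * (weight b h * Real.exp (0.0005 * increment b h e)) * (n : ℝ) ^ 2 := by
          gcongr
        refine le_trans ?_ h3
        nlinarith
      · have : 0 ≤ 5.12e24 * (weight b h ^ 2 * Real.exp (0.001 * increment b h e)) / (n : ℝ) ^ 2 :=
          by positivity
        have h2 : 0 ≤ 1.6e12 * (weight b h * 2) / (n : ℝ) := by positivity
        linarith
      · have : 0 ≤ 5.12e24 * (weight b h ^ 2 * Real.exp (0.001 * increment b h e)) / (n : ℝ) ^ 2 :=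
          by positivity
        linarith

/-- A queue potential below one forces weight below `n`, hence excess at most `n log n / 0.0005`. So
the drift estimates hold whenever the potential is not capped. -/
lemma excess_le_of_queuePotential_lt_one (hn : (1e14 : ℝ) ≤ n)
    (hlog : Real.log n ≤ 5e-10 * n) (hq : queuePotential b h < 1) :
    excess b h ≤ 1e-6 * (n : ℝ) ^ 2 := by
  have hn0 := n_pos (n := n)
  have hw0 := weight_pos (b := b) (h := h)
  have hw : weight b h < n := by
    unfold queuePotential at hq
    split_ifs at hq
    · rw [div_lt_one hn0] at hq
      linarith
    · rw [div_lt_one (by positivity)] at hq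
      apply lt_of_pow_lt_pow_left₀ 2 hn0.le
      nlinarith [sq_nonneg (weight b h)]
  unfold weight at hw
  rw [← Real.lt_log_iff_exp_lt hn0] at hw
  have h1 : excess b h / n ≤ 1e-6 * n := by linarith
  rw [div_le_iff₀ hn0] at h1
  linarith

/-- The potential does not increase on average. -/
lemma sum_potential_le (hn : (1e14 : ℝ) ≤ n) (hlog : Real.log n ≤ 5e-10 * n) (hbn : b + 1 ≤ n)
    (hb : 0.99 * (n : ℝ) - 1 ≤ b) (h : History (Sym2 (Fin n))) :
    ∑ e ∈ free (completeBoard n) h, potential b ((e, (closingStrategy n b).move h e) :: h) ≤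
      freeCount h * potential b h := by
  classical
  have hn0 := n_pos (n := n)
  have hn7 : (1e7 : ℝ) ≤ n := by linarith
  have hbn1 : (b : ℝ) + 1 ≤ n := by exact_mod_cast hbn
  have hbn' : (b : ℝ) ≤ n := by linarith
  have htriv : ∑ e ∈ free (completeBoard n) h,
      potential b ((e, (closingStrategy n b).move h e) :: h) ≤ freeCount h := by
    refine (Finset.sum_le_card_nsmul _ _ 1 fun e _ => potential_le_one).trans ?_
    rw [nsmul_eq_mul, mul_one]
    rfl
  by_cases hs : Safe b h
  swap
  · unfold potential at htriv ⊢
    rw [if_neg hs, mul_one]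
    exact htriv
  by_cases hc : Calm b h
  · rw [Finset.sum_eq_zero fun e he => hs.calm_step hc hn7 (by omega) hb he, potential_eq_zero hs hc,
      mul_zero]
  have hp : Playing b h := hs.2.resolve_left fun h0 => hc (Or.inl h0)
  have hpot : potential b h = min 1 (roundPotential h + queuePotential b h) := by
    unfold potential
    rw [if_pos hs, if_neg hc]
  rw [hpot]
  rcases le_or_gt 1 (roundPotential h + queuePotential b h) with h1 | h1
  · rw [min_eq_left h1, mul_one]
    exact htriv
  rw [min_eq_right h1.le]
  have hr0 : 0 ≤ roundPotential h := roundPotential_nonneg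
  have hex := excess_le_of_queuePotential_lt_one hn hlog (by linarith : queuePotential b h < 1)
  have hE := freeCount_ge_of_excess hex
  have hw0 := weight_pos (b := b) (h := h)
  have hhits := hp.card_hit_le hn7 hex
  have hcE : ((free (completeBoard n) h).card : ℝ) = freeCount h := rfl
  -- The value after a dummy round; only the length of the history counts.
  have hround : 0 ≤ roundPotential h - 1.024e25 / (n : ℝ) ^ 2 := by
    obtain ⟨e, he⟩ : (free (completeBoard n) h).Nonempty := by
      rw [Finset.nonempty_iff_ne_empty]
      exact fun h0 => hc (Or.inl h0)
    rw [← roundPotential_cons (e, ∅) (hp.length_le hn7 hb)]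
    exact roundPotential_nonneg
  by_cases hhit : (stateAfter b h).hit
  · have hpt : ∀ e ∈ free (completeBoard n) h,
        potential b ((e, (closingStrategy n b).move h e) :: h) ≤ roundPotential h +
          1.6e12 * weight b h / n * Real.exp (0.0005 * increment b h e) +
          if IsHit (makerGraph h) (stateAfter b h) e then 1 else 0 := by
      intro e he
      have hpos : 0 ≤ 1.6e12 * weight b h / n * Real.exp (0.0005 * increment b h e) := by
        positivity
      split_ifs with hit'
      · have := potential_le_one (b := b) (h := (e, (closingStrategy n b).move h e) :: h)
        linarith
      · have h2 := hp.potential_succ_le hs.1 hn hbn hb he (fun hcon => hit' hcon.2)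
        unfold successorBound at h2
        rw [if_pos hhit] at h2
        have h3 : (0 : ℝ) ≤ 1.024e25 / (n : ℝ) ^ 2 := by positivity
        have h4 : 1.6e12 * (weight b h * Real.exp (0.0005 * increment b h e)) / (n : ℝ) =
          1.6e12 * weight b h / n * Real.exp (0.0005 * increment b h e) := by ring
        linarith
    refine (Finset.sum_le_sum hpt).trans ?_
    rw [Finset.sum_add_distrib, Finset.sum_add_distrib, ← Finset.mul_sum, Finset.sum_const,
      nsmul_eq_mul, hcE, Finset.sum_boole]
    have h2 := hp.sum_exp_increment_le hn7 hbn' hb hex (μ := 0.0005) le_rfl (by norm_num)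
    have h3 := mul_le_mul_of_nonneg_left h2
      (by positivity : (0 : ℝ) ≤ 1.6e12 * weight b h / n)
    -- The drift gain pays for the second hits, each of which costs one. This fixes 1.6e12 =
    -- 8000/(1e-5 · 0.0005).
    have h4 : 8000 * (n * weight b h) ≤ 1.6e12 * weight b h / n * (1e-5 * freeCount h) := by
      have : 1.6e12 * weight b h / n * (1e-5 * (0.0005 * (n : ℝ) ^ 2)) = 8000 * (n * weight b h) :=
        by field_simp; norm_num
      rw [← this]
      gcongr
    unfold queuePotential
    rw [if_pos hhit]
    linarith
  · have hpt : ∀ e ∈ free (completeBoard n) h,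
        potential b ((e, (closingStrategy n b).move h e) :: h) ≤ roundPotential h +
          5.12e24 * weight b h ^ 2 / (n : ℝ) ^ 2 * Real.exp (0.001 * increment b h e) +
          3.2e12 * weight b h / n *
            if IsHit (makerGraph h) (stateAfter b h) e then 1 else 0 := by
      intro e he
      have h2 := hp.potential_succ_le hs.1 hn hbn hb he (fun hcon => hhit hcon.1)
      unfold successorBound at h2
      rw [if_neg hhit] at h2
      refine h2.trans (le_of_eq ?_)
      split_ifs <;> ring
    refine (Finset.sum_le_sum hpt).trans ?_
    rw [Finset.sum_add_distrib, Finset.sum_add_distrib, ← Finset.mul_sum, ← Finset.mul_sum,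
      Finset.sum_const, nsmul_eq_mul, hcE, Finset.sum_boole]
    have h2 := hp.sum_exp_increment_le hn7 hbn' hb hex (μ := 0.001) (by norm_num) le_rfl
    have h3 := mul_le_mul_of_nonneg_left h2
      (by positivity : (0 : ℝ) ≤ 5.12e24 * weight b h ^ 2 / (n : ℝ) ^ 2)
    have h4 := mul_le_mul_of_nonneg_left hhits
      (by positivity : (0 : ℝ) ≤ 3.2e12 * weight b h / n)
    -- The same balance for first hits, which lead to the potential `weight/n` with weight at most
    -- doubled: 5.12e24 = 3.2e12 · 8000/(1e-5 · 0.0005).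
    have h5 : 3.2e12 * weight b h / n * (8000 * (n * weight b h)) ≤
        5.12e24 * weight b h ^ 2 / (n : ℝ) ^ 2 * (1e-5 * freeCount h) := by
      have h6 : 3.2e12 * weight b h / n * (8000 * (n * weight b h)) =
          5.12e24 * weight b h ^ 2 / (n : ℝ) ^ 2 * (1e-5 * (0.0005 * (n : ℝ) ^ 2)) := by
        field_simp; norm_num
      rw [h6]
      gcongr
    unfold queuePotential
    rw [if_neg hhit]
    linarith

end Step

end MakerBreaker

namespace MakerBreaker

/-! ### Expectations of the potential -/

section Expectation

lemma tsum_bind_mul {α β : Type*} (p : PMF α) (f : α → PMF β) (g : β → ℝ≥0∞) :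
    ∑' y, p.bind f y * g y = ∑' x, p x * ∑' y, f x y * g y := by
  simp only [PMF.bind_apply, ← ENNReal.tsum_mul_right, ← ENNReal.tsum_mul_left]
  rw [ENNReal.tsum_comm]
  simp only [mul_assoc]

lemma tsum_pure_mul {α : Type*} (a : α) (g : α → ℝ≥0∞) : ∑' y, PMF.pure a y * g y = g a := by
  rw [tsum_eq_single a]
  · simp
  · intro y hy
    rw [PMF.pure_apply_of_ne _ _ hy, zero_mul]

lemma tsum_map_mul {α β : Type*} (p : PMF α) (f : α → β) (g : β → ℝ≥0∞) :
    ∑' y, p.map f y * g y = ∑' x, p x * g (f x) := by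
  rw [← PMF.bind_pure_comp, tsum_bind_mul]
  simp only [Function.comp_apply, tsum_pure_mul]

lemma toOuterMeasure_add_compl {α : Type*} (p : PMF α) (s : Set α) :
    p.toOuterMeasure s + p.toOuterMeasure sᶜ = 1 := by
  rw [PMF.toOuterMeasure_apply, PMF.toOuterMeasure_apply, ← ENNReal.tsum_add, ← p.tsum_coe]
  congr 1
  funext x
  by_cases hx : x ∈ s <;> simp [hx]

variable {n : ℕ} [NeZero n] {b : ℕ}

lemma tsum_randomMakerRound_le (hn : (1e14 : ℝ) ≤ n) (hlog : Real.log n ≤ 5e-10 * n)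
    (hbn : b + 1 ≤ n) (hb : 0.99 * (n : ℝ) - 1 ≤ b) (h : History (Sym2 (Fin n))) :
    ∑' h', randomMakerRound (closingStrategy n b) h h' * ENNReal.ofReal (potential b h') ≤
      ENNReal.ofReal (potential b h) := by
  classical
  unfold randomMakerRound
  split_ifs with hX
  · rw [tsum_map_mul, tsum_eq_sum (s := free (completeBoard n) h)]
    · have hc : 0 < (free (completeBoard n) h).card := Finset.card_pos.2 hX
      have hle : ∑ e ∈ free (completeBoard n) h,
          ENNReal.ofReal (potential b ((e, (closingStrategy n b).move h e) :: h)) ≤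
          (free (completeBoard n) h).card * ENNReal.ofReal (potential b h) := by
        rw [← ENNReal.ofReal_sum_of_nonneg fun e _ => potential_nonneg,
          ← ENNReal.ofReal_natCast, ← ENNReal.ofReal_mul (Nat.cast_nonneg _)]
        exact ENNReal.ofReal_le_ofReal (sum_potential_le hn hlog hbn hb h)
      calc ∑ e ∈ free (completeBoard n) h, PMF.uniformOfFinset (free (completeBoard n) h) hX e *
            ENNReal.ofReal (potential b ((e, (closingStrategy n b).move h e) :: h))
          = ((free (completeBoard n) h).card : ℝ≥0∞)⁻¹ * ∑ e ∈ free (completeBoard n) h,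
            ENNReal.ofReal (potential b ((e, (closingStrategy n b).move h e) :: h)) := by
            rw [Finset.mul_sum]
            refine Finset.sum_congr rfl fun e he => ?_
            rw [PMF.uniformOfFinset_apply_of_mem hX he]
        _ ≤ ((free (completeBoard n) h).card : ℝ≥0∞)⁻¹ *
            ((free (completeBoard n) h).card * ENNReal.ofReal (potential b h)) := by gcongr
        _ = ENNReal.ofReal (potential b h) := by
            rw [← mul_assoc, ENNReal.inv_mul_cancel, one_mul]
            · exact_mod_cast hc.ne'
            · exact ENNReal.natCast_ne_top _
    · intro e he
      rw [PMF.uniformOfFinset_apply_of_notMem hX he, zero_mul]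
  · rw [tsum_pure_mul]

lemma tsum_randomMakerPlay_le (hn : (1e14 : ℝ) ≤ n) (hlog : Real.log n ≤ 5e-10 * n)
    (hbn : b + 1 ≤ n) (hb : 0.99 * (n : ℝ) - 1 ≤ b) (t : ℕ) :
    ∑' h, randomMakerPlay (closingStrategy n b) t h * ENNReal.ofReal (potential b h) ≤
      ENNReal.ofReal (potential b ([] : History (Sym2 (Fin n)))) := by
  induction t with
  | zero => rw [randomMakerPlay, tsum_pure_mul]
  | succ t ih =>
    rw [randomMakerPlay, tsum_bind_mul]
    refine le_trans (ENNReal.tsum_le_tsum fun h => ?_) ih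
    gcongr
    exact tsum_randomMakerRound_le hn hlog hbn hb h

lemma potential_nil_le (hn : (1e14 : ℝ) ≤ n) :
    potential b ([] : History (Sym2 (Fin n))) ≤ 2.048e25 / n := by
  have hn0 := n_pos (n := n)
  refine (potential_le (safe_nil b)).trans ?_
  have h1 : roundPotential ([] : History (Sym2 (Fin n))) = 1.024e25 / n := by
    unfold roundPotential
    rw [List.length_nil, Nat.cast_zero, sub_zero, max_eq_right hn0.le]
    field_simp
  have hcard : freeCount ([] : History (Sym2 (Fin n))) = n * (n - 1) / 2 := by
    unfold freeCount
    rw [free_nil, card_completeBoard, Nat.cast_choose_two]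
  have hne : free (completeBoard n) ([] : History (Sym2 (Fin n))) ≠ ∅ := by
    intro h0
    unfold freeCount at hcard
    rw [h0, Finset.card_empty, Nat.cast_zero] at hcard
    nlinarith
  have hp : Playing b ([] : History (Sym2 (Fin n))) := (safe_nil b).2.resolve_left hne
  have hload : load b ([] : History (Sym2 (Fin n))) ≤ n := by
    obtain ⟨-, -, -, -, -, -, h7, -⟩ := hp.bounds
    have h8 : load b ([] : History (Sym2 (Fin n))) ≤ openCount b ([] : History (Sym2 (Fin n))) := by
      unfold load openCount
      exact_mod_cast hp.sound.touching_singleton_le 0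
    exact h8.trans h7
  have hw : weight b ([] : History (Sym2 (Fin n))) ^ 2 ≤ 2 := by
    have hex : excess b ([] : History (Sym2 (Fin n))) / n ≤ 1 := by
      rw [div_le_one hn0]
      unfold excess
      rw [max_eq_left (by rw [hcard]; nlinarith)]
      linarith
    unfold weight
    rw [← Real.exp_nat_mul]
    apply exp_le_two
    push_cast
    linarith
  have h2 : queuePotential b ([] : History (Sym2 (Fin n))) ≤ 1.024e25 / n := by
    unfold queuePotential
    rw [if_neg (by simp [stateAfter, initialState])]
    rw [div_le_div_iff₀ (by positivity) hn0]
    nlinarith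
  rw [h1]
  calc 1.024e25 / (n : ℝ) + queuePotential b ([] : History (Sym2 (Fin n)))
      ≤ 1.024e25 / n + 1.024e25 / n := by linarith
    _ = 2.048e25 / n := by ring

/-- Markov's inequality: a history lost for Breaker is not safe, so its potential is one, and the
expected potential never exceeds its initial value. -/
lemma one_sub_le_cleverBreakerWinProb (hn : (1e14 : ℝ) ≤ n) (hlog : Real.log n ≤ 5e-10 * n)
    (hbn : b + 1 ≤ n) (hb : 0.99 * (n : ℝ) - 1 ≤ b) :
    1 - ENNReal.ofReal (2.048e25 / n) ≤ cleverBreakerWinProb n b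
      (fun M => IsGraphMinor (SimpleGraph.pathGraph 11) M) := by
  refine le_trans ?_ (le_iSup _ (closingStrategy n b))
  unfold breakerWinProb
  set p := randomMakerPlay (closingStrategy n b) (completeBoard n).card with hp
  set W : Set (History (Sym2 (Fin n))) :=
    {h | ¬ IsGraphMinor (SimpleGraph.pathGraph 11) (makerGraph h)} with hW
  have hloss : p.toOuterMeasure Wᶜ ≤ ENNReal.ofReal (2.048e25 / n) := by
    rw [PMF.toOuterMeasure_apply]
    refine le_trans (ENNReal.tsum_le_tsum fun h => ?_)
      ((tsum_randomMakerPlay_le hn hlog hbn hb (completeBoard n).card).trans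
        (ENNReal.ofReal_le_ofReal (potential_nil_le hn)))
    by_cases hh : h ∈ Wᶜ
    · rw [Set.indicator_of_mem hh]
      have hns : ¬ Safe b h := fun hs => hh (not_isGraphMinor_pathGraph hs.1)
      have : potential b h = 1 := by
        unfold potential
        rw [if_neg hns]
      rw [this, ENNReal.ofReal_one, mul_one]
    · rw [Set.indicator_of_notMem hh]
      exact zero_le
  rw [tsub_le_iff_right, ← toOuterMeasure_add_compl p W]
  gcongr

end Expectation

end MakerBreaker

theorem theorem2 (b : ℕ → ℕ) (hb : ∀ n : ℕ, |(b n : ℝ) - 0.99 * (n : ℝ)| < 1) :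
    Tendsto
      (fun n : ℕ => MakerBreaker.cleverBreakerWinProb n (b n)
        (fun M => IsGraphMinor (SimpleGraph.pathGraph 11) M))
      atTop (𝓝 1) := by
  have hlim : Tendsto (fun n : ℕ => 1 - ENNReal.ofReal (2.048e25 / (n : ℝ))) atTop (𝓝 1) := by
    have h1 : Tendsto (fun n : ℕ => ENNReal.ofReal (2.048e25 / (n : ℝ))) atTop (𝓝 0) := by
      rw [← ENNReal.ofReal_zero]
      exact ENNReal.tendsto_ofReal (tendsto_const_div_atTop_nhds_zero_nat _)
    simpa using ENNReal.Tendsto.sub tendsto_const_nhds h1 (Or.inl ENNReal.one_ne_top)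
  refine tendsto_of_tendsto_of_tendsto_of_le_of_le' hlim tendsto_const_nhds ?_ ?_
  · have hlog : ∀ᶠ n : ℕ in atTop, Real.log n ≤ 5e-10 * n := by
      have h1 := (Real.isLittleO_log_id_atTop.def (by norm_num : (0 : ℝ) < 5e-10))
      filter_upwards [tendsto_natCast_atTop_atTop.eventually h1] with n hn
      rw [id, Real.norm_eq_abs, Real.norm_eq_abs, Nat.abs_cast] at hn
      exact (le_abs_self _).trans hn
    filter_upwards [hlog, tendsto_natCast_atTop_atTop.eventually (eventually_ge_atTop (1e14 : ℝ))]
      with n hlogn hn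
    have hbn := abs_lt.1 (hb n)
    have : NeZero n := ⟨by rintro rfl; norm_num at hn⟩
    refine MakerBreaker.one_sub_le_cleverBreakerWinProb hn hlogn ?_ (by linarith)
    have : (b n : ℝ) + 1 ≤ n := by linarith
    exact_mod_cast this
  · refine Eventually.of_forall fun n => iSup_le fun σ => ?_
    unfold MakerBreaker.breakerWinProb
    rw [← MakerBreaker.toOuterMeasure_add_compl]
    exact le_self_add
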